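/- A function $\Psi\colon[0,\infty)\to[0,\infty)$ is called an Orlicz function if it is convex, strictly increasing and $\Psi(0)=0$; write $\Psi(x)=e^{\psi(x)}-1$. Say that $\Psi$ satisfies (HJ) if there is a constant $K>0$ such that $\psi(su)\le K\bigl(s\ln(1+s)+s\psi(u)\bigr)$ for all $s,u\ge K$. For an Orlicz function $\Phi$ and a real random variable $Y$ put $\|Y\|_\Phi=\inf\{a>0:\mathbb E\,\Phi(|Y|/a)\le 1\}$ (with $\inf\emptyset=\infty$). **Proposition 4.6.** Let $\Psi$ be an Orlicz function satisfying (HJ) and let $\Phi(x)=\Psi(x^2)$, $x\ge 0$. There is a constant $c_\Phi\in(0,\infty)$, depending only on $\Phi$, such that the following holds. Let $X=(X_1,\dots,X_N)$ be an $\mathbb R^N$-valued random variable with independent coordinates such that $\bigl\|\max_{i\le N}|X_i|\bigr\|_\Phi<\infty$, and let $f\colon\mathbb R^N\to\mathbb R$ be convex and $1$-Lipschitz with respect to the Euclidean norm. Then $\max_{i\le N}|X_i|$ and $f(X)$ are integrable, and for every $t>0$ $$\mathbb P\bigl(|f(X)-\mathbb Ef(X)|>t\bigr)\le 2\exp\Bigl(-c_\Phi\frac{t^2}{(\mathbb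 E\max_{i\le N}|X_i|)^2}\Bigr)+\frac{2}{\Phi\Bigl(c_\Phi\frac{t}{\|\max_{i\le N}|X_i|\|_\Phi}\Bigr)+1},$$ where the right-hand side is read as $0$ if $X=0$ almost surely. -/

import Mathlib

open MeasureTheory ProbabilityTheory
open scoped ENNReal

noncomputable section

/-- An Orlicz function: convex, strictly increasing on `[0, ∞)` and zero at the origin (hence
nonnegative there). Only the values on `[0, ∞)` are meaningful. -/
structure IsOrlicz (Ψ : ℝ → ℝ) : Prop where
  convexOn : ConvexOn ℝ (Set.Ici 0) Ψ
  strictMonoOn : StrictMonoOn Ψ (Set.Ici 0)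
  map_zero : Ψ 0 = 0

/-- The exponent `ψ` of an Orlicz function, determined by `Ψ x = exp (ψ x) - 1` for `x ≥ 0`. -/
def orliczExponent (Ψ : ℝ → ℝ) (x : ℝ) : ℝ := Real.log (1 + Ψ x)

/-- The condition (HJ): for some `K > 0` and all `s, u ≥ K`,
`ψ (s u) ≤ K (s ln (1 + s) + s ψ(u))`. -/
def SatisfiesHJ (Ψ : ℝ → ℝ) : Prop :=
  ∃ K : ℝ, 0 < K ∧ ∀ s u : ℝ, K ≤ s → K ≤ u →
    orliczExponent Ψ (s * u) ≤ K * (s * Real.log (1 + s) + s * orliczExponent Ψ u)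

/-- The Orlicz (Luxemburg) norm `inf {a > 0 : E Ψ(|Y| / a) ≤ 1}`, with value `∞` if there is no
such `a`. -/
def orliczNorm {Ω : Type*} [MeasurableSpace Ω] (Ψ : ℝ → ℝ) (Y : Ω → ℝ) (μ : Measure Ω) : ℝ≥0∞ :=
  ⨅ (a : ℝ) (_ : 0 < a) (_ : ∫⁻ ω, ENNReal.ofReal (Ψ (|Y ω| / a)) ∂μ ≤ 1), ENNReal.ofReal a

/-- The random variable `max_i |X_i|` of finitely many real random variables. -/
def maxAbs {Ω : Type*} {N : ℕ} (X : Fin N → Ω → ℝ) (ω : Ω) : ℝ := ⨆ i, |X i ω|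

/-- The random vector in Euclidean space with coordinates `X_i`. -/
def randVec {Ω : Type*} {N : ℕ} (X : Fin N → Ω → ℝ) (ω : Ω) : EuclideanSpace ℝ (Fin N) :=
  WithLp.toLp 2 (fun i => X i ω)

end

open MeasureTheory ProbabilityTheory
open scoped ENNReal

/-! Put m = E max|X_i| and replace by 0 every coordinate exceeding M = 2m in absolute value. The
resulting vector X' has bounded independent coordinates, so f(X') is sub-Gaussian with variance
proxy of order m² (`hasSubgaussianMGF_of_convexOn_of_lipschitz`). This rests on Maurey's inequality
E e^{Qf} · E e^{-f} ≤ 1 for convex f, where Q is infimum convolution with a quadratic cost; it is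
elementary in dimension one and tensorizes (`lintegral_infConv_mul_le_one`).

The remainder R = |X - X'| satisfies R² = ∑ X_i² 1{|X_i| > M}. By Markov max|X_i| ≤ M with
probability at least 1/2, so summed moments of the large coordinates are at most twice the moment of
the maximum (`sum_lintegral_ite_lt_abs_le`). Hence E R ≤ 2m, which controls the change of mean.

For the tail of R²/a², terms above a level v are left to the tail of the maximum, and Chernoff's
bound with λ of order ψ(v)/v treats the others. Condition (HJ) bounds e^{λz} - 1 by Cψ(v)(1 + Ψ(z))
for z ≤ v (`exp_sub_one_le_of_HJ`), so the logarithmic moments add up to O(ψ(v)) and the tail is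
O(1/(1 + Ψ(γt))) (`exists_tail_bound_sum_sq`). As Ψ(x²) = Φ(x), this is a Φ-tail for R; convexity of
Ψ turns the multiplicative constant into a dilation. -/

/-! ### The convex transport inequality in dimension one. -/

theorem exp_sub_add_exp_neg_le_two {u : ℝ} (h0 : 0 ≤ u) (h1 : u ≤ 1 / 4) :
    Real.exp (u - 2 * u ^ 2) + Real.exp (-u) ≤ 2 := by
  -- The bound |e^x - 1 - x| ≤ x², used twice: the gain -2u² pays for both quadratic errors.
  have e1 := (abs_le.1 (Real.abs_exp_sub_one_sub_id_le (x := u - 2 * u ^ 2)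
    (by rw [abs_le]; constructor <;> nlinarith))).2
  have e2 := (abs_le.1 (Real.abs_exp_sub_one_sub_id_le (x := -u)
    (by rw [abs_le]; constructor <;> nlinarith))).2
  have e3 : (u - 2 * u ^ 2) ^ 2 ≤ u ^ 2 := by
    apply pow_le_pow_left₀ <;> nlinarith
  nlinarith

theorem exp_eighth_add_exp_neg_le_two {u : ℝ} (h1 : 1 / 4 ≤ u) :
    Real.exp (1 / 8) + Real.exp (-u) ≤ 2 := by
  have e1 := (abs_le.1 (Real.abs_exp_sub_one_sub_id_le (x := 1 / 8)
    (by rw [abs_le]; constructor <;> norm_num))).2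
  have e2 := (abs_le.1 (Real.abs_exp_sub_one_sub_id_le (x := -(1 / 4))
    (by rw [abs_le]; constructor <;> norm_num))).2
  have e3 : Real.exp (-u) ≤ Real.exp (-(1 / 4)) := Real.exp_le_exp.2 (by linarith)
  norm_num at e1
  linarith

/-- The pointwise bound behind the one-dimensional convex transport inequality. -/
theorem exists_exp_add_sq_le {M : ℝ} (hM : 0 < M) {φ : ℝ → ℝ} (hφ : ConvexOn ℝ Set.univ φ)
    {a s : ℝ} (ha : a ∈ Set.Icc (-M) M) (hs : s ∈ Set.Icc (-M) M) (has : φ a ≤ φ s) :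
    ∃ r, Real.exp (φ r + (s - r) ^ 2 / (8 * (2 * M) ^ 2)) ≤
      Real.exp (φ a) * (2 - Real.exp (-(φ s - φ a))) := by
  set u := φ s - φ a with hu
  have hu0 : 0 ≤ u := by linarith
  have hsa : (s - a) ^ 2 ≤ (2 * M) ^ 2 := by
    apply sq_le_sq'
    · linarith [hs.1, ha.2]
    · linarith [hs.2, ha.1]
  have hD : 0 < (2 * M) ^ 2 := by positivity
  have key : ∀ θ : ℝ, 0 ≤ θ → θ ≤ 1 →
      φ ((1 - θ) * s + θ * a) + (s - ((1 - θ) * s + θ * a)) ^ 2 / (8 * (2 * M) ^ 2) ≤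
        φ a + ((1 - θ) * u + θ ^ 2 / 8) := by
    intro θ h0 h1
    have h2 := hφ.2 (Set.mem_univ s) (Set.mem_univ a) (sub_nonneg.2 h1) h0 (by ring)
    simp only [smul_eq_mul] at h2
    have h3 : (s - ((1 - θ) * s + θ * a)) ^ 2 / (8 * (2 * M) ^ 2) ≤ θ ^ 2 / 8 := by
      rw [div_le_div_iff₀ (by positivity) (by norm_num)]
      have : (s - ((1 - θ) * s + θ * a)) ^ 2 = θ ^ 2 * (s - a) ^ 2 := by ring
      rw [this]
      nlinarith [mul_le_mul_of_nonneg_left hsa (sq_nonneg θ)]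
    have h4 : (1 - θ) * φ s + θ * φ a = φ a + (1 - θ) * u := by rw [hu]; ring
    linarith
  -- On the segment from s to a the bound (1 - θ)u + θ²/8 is minimal at θ = 4u if that is at most 1,
  -- and at θ = 1 otherwise.
  rcases le_total u (1 / 4) with h | h
  · refine ⟨_, (Real.exp_le_exp.2 (key (4 * u) (by linarith) (by linarith))).trans ?_⟩
    rw [Real.exp_add]
    refine mul_le_mul_of_nonneg_left ?_ (Real.exp_pos _).le
    have := exp_sub_add_exp_neg_le_two hu0 h
    have e : (1 - 4 * u) * u + (4 * u) ^ 2 / 8 = u - 2 * u ^ 2 := by ring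
    rw [e]
    linarith
  · refine ⟨_, (Real.exp_le_exp.2 (key 1 (by norm_num) le_rfl)).trans ?_⟩
    rw [Real.exp_add]
    refine mul_le_mul_of_nonneg_left ?_ (Real.exp_pos _).le
    have := exp_eighth_add_exp_neg_le_two h
    have e : (1 - 1) * u + 1 ^ 2 / 8 = (1 / 8 : ℝ) := by ring
    rw [e]
    linarith

theorem ConvexOn.continuous_of_univ {E : Type*} [NormedAddCommGroup E] [NormedSpace ℝ E]
    [FiniteDimensional ℝ E] {f : E → ℝ} (hf : ConvexOn ℝ Set.univ f) : Continuous f :=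
  hf.locallyLipschitz.continuous

/-- The one-dimensional convex transport inequality on a bounded interval. -/
theorem lintegral_mul_lintegral_exp_neg_le_one {M : ℝ} (hM : 0 < M) (μ : Measure ℝ)
    [IsProbabilityMeasure μ] (hμ : ∀ᵐ s ∂μ, s ∈ Set.Icc (-M) M) {φ : ℝ → ℝ}
    (hφ : ConvexOn ℝ Set.univ φ) {G : ℝ → ℝ≥0∞}
    (hG : ∀ s r, G s ≤ ENNReal.ofReal (Real.exp (φ r + (s - r) ^ 2 / (8 * (2 * M) ^ 2)))) :
    (∫⁻ s, G s ∂μ) * ∫⁻ s, ENNReal.ofReal (Real.exp (-φ s)) ∂μ ≤ 1 := by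
  have hc : Continuous φ := hφ.continuous_of_univ
  obtain ⟨a, ha, hmin⟩ := isCompact_Icc.exists_isMinOn (s := Set.Icc (-M) M)
    ⟨0, by constructor <;> linarith⟩ hc.continuousOn
  set J := ∫ s, Real.exp (-(φ s - φ a)) ∂μ with hJ
  have hint : Integrable (fun s => Real.exp (-(φ s - φ a))) μ := by
    refine Integrable.of_bound (by fun_prop) 1 ?_
    filter_upwards [hμ] with s hs
    rw [Real.norm_of_nonneg (Real.exp_pos _).le, Real.exp_le_one_iff]
    have : φ a ≤ φ s := hmin hs
    linarith
  have hle1 : ∀ᵐ s ∂μ, Real.exp (-(φ s - φ a)) ≤ 1 := by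
    filter_upwards [hμ] with s hs
    rw [Real.exp_le_one_iff]
    have : φ a ≤ φ s := hmin hs
    linarith
  have hJ1 : J ≤ 1 := by
    calc J ≤ ∫ _, (1 : ℝ) ∂μ := integral_mono_ae hint (integrable_const _) hle1
      _ = 1 := by simp
  have hJ0 : 0 ≤ J := integral_nonneg fun _ => (Real.exp_pos _).le
  have h1 : ∫⁻ s, G s ∂μ ≤ ENNReal.ofReal (Real.exp (φ a) * (2 - J)) := by
    calc ∫⁻ s, G s ∂μ
        ≤ ∫⁻ s, ENNReal.ofReal (Real.exp (φ a) * (2 - Real.exp (-(φ s - φ a)))) ∂μ := by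
          refine lintegral_mono_ae ?_
          filter_upwards [hμ] with s hs
          obtain ⟨r, hr⟩ := exists_exp_add_sq_le hM hφ ha hs (hmin hs)
          exact (hG s r).trans (ENNReal.ofReal_le_ofReal hr)
      _ = ENNReal.ofReal (∫ s, Real.exp (φ a) * (2 - Real.exp (-(φ s - φ a))) ∂μ) := by
          rw [ofReal_integral_eq_lintegral_ofReal]
          · exact ((integrable_const _).sub hint).const_mul _
          · filter_upwards [hle1] with s hs
            exact mul_nonneg (Real.exp_pos _).le (by linarith)
      _ = _ := by
          rw [integral_const_mul, integral_sub (integrable_const _) hint]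
          simp [hJ]
  have h2 : ∫⁻ s, ENNReal.ofReal (Real.exp (-φ s)) ∂μ =
      ENNReal.ofReal (Real.exp (-φ a) * J) := by
    rw [hJ, ← integral_const_mul, ofReal_integral_eq_lintegral_ofReal (hint.const_mul _)
      (ae_of_all _ fun _ => by positivity)]
    refine lintegral_congr fun s => ?_
    rw [← Real.exp_add]
    congr 2
    ring
  rw [h2]
  refine (mul_le_mul_left h1 _).trans ?_
  rw [← ENNReal.ofReal_mul (mul_nonneg (Real.exp_pos _).le (by linarith)), ENNReal.ofReal_le_one]
  -- The factors e^{±φ(a)} cancel, leaving (2 - J)J = 1 - (1 - J)².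
  have : Real.exp (φ a) * (2 - J) * (Real.exp (-φ a) * J) =
      (Real.exp (φ a) * Real.exp (-φ a)) * ((2 - J) * J) := by ring
  rw [this, ← Real.exp_add, add_neg_cancel, Real.exp_zero]
  nlinarith [sq_nonneg (J - 1)]

/-! ### Infimum convolution and convexity. -/

/-- Partial minimization preserves convexity. -/
theorem ConvexOn.iInf_snd {E F : Type*} [AddCommGroup E] [Module ℝ E] [AddCommGroup F] [Module ℝ F]
    {g : E × F → ℝ} (hg : ConvexOn ℝ Set.univ g)
    (hb : ∀ x, BddBelow (Set.range fun y => g (x, y))) :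
    ConvexOn ℝ Set.univ fun x => ⨅ y, g (x, y) := by
  refine ⟨convex_univ, fun x _ x' _ a b ha hb' hab => ?_⟩
  refine le_of_forall_pos_le_add fun ε hε => ?_
  obtain ⟨y, hy⟩ := exists_lt_of_ciInf_lt
    (show (⨅ y, g (x, y)) < (⨅ y, g (x, y)) + ε by linarith)
  obtain ⟨y', hy'⟩ := exists_lt_of_ciInf_lt
    (show (⨅ y, g (x', y)) < (⨅ y, g (x', y)) + ε by linarith)
  have h1 := hg.2 (Set.mem_univ (x, y)) (Set.mem_univ (x', y')) ha hb' hab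
  have h2 : (⨅ z, g (a • x + b • x', z)) ≤ g (a • x + b • x', a • y + b • y') :=
    ciInf_le (hb _) _
  simp only [Prod.smul_mk, Prod.mk_add_mk, smul_eq_mul] at h1 ⊢
  have h3 := mul_le_mul_of_nonneg_left hy.le ha
  have h4 := mul_le_mul_of_nonneg_left hy'.le hb'
  have h5 : a * ε + b * ε = ε := by rw [← add_mul, hab, one_mul]
  linarith

/-- The infimum convolution of `f` with `κ` times the squared Euclidean norm. -/
noncomputable def infConv {n : ℕ} (κ : ℝ) (f : (Fin n → ℝ) → ℝ) (x : Fin n → ℝ) : ℝ :=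
  ⨅ y, (f y + κ * ∑ i, (x i - y i) ^ 2)

section InfConv

variable {n : ℕ} {κ b : ℝ} {f : (Fin n → ℝ) → ℝ}

theorem infConv_bddBelow (hκ : 0 ≤ κ) (hb : ∀ x, b ≤ f x) (x : Fin n → ℝ) :
    BddBelow (Set.range fun y => f y + κ * ∑ i, (x i - y i) ^ 2) := by
  refine ⟨b, ?_⟩
  rintro _ ⟨y, rfl⟩
  have : 0 ≤ κ * ∑ i, (x i - y i) ^ 2 := by positivity
  linarith [hb y]

theorem infConv_le (hκ : 0 ≤ κ) (hb : ∀ x, b ≤ f x) (x y : Fin n → ℝ) :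
    infConv κ f x ≤ f y + κ * ∑ i, (x i - y i) ^ 2 :=
  ciInf_le (infConv_bddBelow hκ hb x) y

theorem infConv_le_self (hκ : 0 ≤ κ) (hb : ∀ x, b ≤ f x) (x : Fin n → ℝ) :
    infConv κ f x ≤ f x := by
  simpa using infConv_le hκ hb x x

theorem le_infConv (hκ : 0 ≤ κ) (hb : ∀ x, b ≤ f x) (x : Fin n → ℝ) : b ≤ infConv κ f x := by
  refine le_ciInf fun y => ?_
  have : 0 ≤ κ * ∑ i, (x i - y i) ^ 2 := by positivity
  linarith [hb y]

theorem convexOn_sum_sq_sub (n : ℕ) :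
    ConvexOn ℝ Set.univ fun p : (Fin n → ℝ) × (Fin n → ℝ) => ∑ i, (p.1 i - p.2 i) ^ 2 := by
  refine ⟨convex_univ, fun p _ q _ a b ha hb hab => ?_⟩
  simp only [Prod.fst_add, Prod.smul_fst, Prod.snd_add, Prod.smul_snd, Pi.add_apply, Pi.smul_apply,
    smul_eq_mul, Finset.mul_sum, ← Finset.sum_add_distrib]
  refine Finset.sum_le_sum fun i _ => ?_
  have := (even_two.convexOn_pow (𝕜 := ℝ)).2 (Set.mem_univ (p.1 i - p.2 i))
    (Set.mem_univ (q.1 i - q.2 i)) ha hb hab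
  simp only [smul_eq_mul] at this
  refine le_trans (le_of_eq ?_) this
  ring

theorem convexOn_infConv (hκ : 0 ≤ κ) (hb : ∀ x, b ≤ f x) (hf : ConvexOn ℝ Set.univ f) :
    ConvexOn ℝ Set.univ (infConv κ f) := by
  have h : ConvexOn ℝ Set.univ fun p : (Fin n → ℝ) × (Fin n → ℝ) =>
      f p.2 + κ * ∑ i, (p.1 i - p.2 i) ^ 2 := by
    refine ConvexOn.add ?_ ((convexOn_sum_sq_sub n).smul hκ)
    exact hf.comp_linearMap (LinearMap.snd ℝ _ _)
  exact h.iInf_snd (infConv_bddBelow hκ hb)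

theorem cons_convexComb (a b r r' : ℝ) (x x' : Fin n → ℝ) :
    (Fin.cons (a * r + b * r') (a • x + b • x') : Fin (n + 1) → ℝ) =
      a • (Fin.cons r x : Fin (n + 1) → ℝ) + b • (Fin.cons r' x' : Fin (n + 1) → ℝ) := by
  ext i
  refine Fin.cases ?_ (fun j => ?_) i <;> simp

theorem convexOn_comp_cons {f : (Fin (n + 1) → ℝ) → ℝ} (hf : ConvexOn ℝ Set.univ f) (r : ℝ) :
    ConvexOn ℝ Set.univ fun x : Fin n → ℝ => f (Fin.cons r x) := by
  refine ⟨convex_univ, fun x _ x' _ a b ha hb hab => ?_⟩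
  have := hf.2 (Set.mem_univ (Fin.cons r x : Fin (n + 1) → ℝ)) (Set.mem_univ (Fin.cons r x')) ha hb hab
  rw [← cons_convexComb, ← add_mul, hab, one_mul] at this
  exact this

/-- Joint convexity in (r, y) survives minimization over y. In the tensorization this makes the
logarithm of the partial integral convex in the first coordinate. -/
theorem convexOn_infConv_cons (hκ : 0 ≤ κ) {f : (Fin (n + 1) → ℝ) → ℝ} (hb : ∀ x, b ≤ f x)
    (hf : ConvexOn ℝ Set.univ f) (x : Fin n → ℝ) :
    ConvexOn ℝ Set.univ fun r : ℝ => infConv κ (fun y => f (Fin.cons r y)) x := by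
  have h : ConvexOn ℝ Set.univ fun p : ℝ × (Fin n → ℝ) =>
      f (Fin.cons p.1 p.2) + κ * ∑ i, (x i - p.2 i) ^ 2 := by
    refine ConvexOn.add ?_ (ConvexOn.smul hκ ?_)
    · refine ⟨convex_univ, fun p _ q _ a b ha hb hab => ?_⟩
      have := hf.2 (Set.mem_univ (Fin.cons p.1 p.2 : Fin (n + 1) → ℝ))
        (Set.mem_univ (Fin.cons q.1 q.2)) ha hb hab
      rw [← cons_convexComb] at this
      exact this
    · refine ⟨convex_univ, fun p _ q _ a b ha hb hab => ?_⟩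
      have := (convexOn_sum_sq_sub n).2 (Set.mem_univ (x, p.2)) (Set.mem_univ (x, q.2)) ha hb hab
      rw [Prod.smul_mk, Prod.smul_mk, Prod.mk_add_mk, ← add_smul, hab, one_smul] at this
      exact this
  exact h.iInf_snd fun r => infConv_bddBelow hκ (fun y => hb _) x

/-- Testing only points with first coordinate r suffices, because the quadratic cost is additive
over coordinates. -/
theorem infConv_cons_le (hκ : 0 ≤ κ) {f : (Fin (n + 1) → ℝ) → ℝ} (hb : ∀ x, b ≤ f x)
    (s r : ℝ) (x : Fin n → ℝ) :
    infConv κ f (Fin.cons s x) ≤ infConv κ (fun y => f (Fin.cons r y)) x + κ * (s - r) ^ 2 := by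
  rw [← sub_le_iff_le_add]
  refine le_ciInf fun y => ?_
  have := infConv_le hκ hb (Fin.cons s x) (Fin.cons r y)
  rw [Fin.sum_univ_succ] at this
  simp only [Fin.cons_zero, Fin.cons_succ] at this
  linarith

end InfConv

/-! ### Tensorization over product measures. -/

theorem ae_pi_forall_mem {ι : Type*} [Fintype ι] (μ : ι → Measure ℝ)
    [∀ i, IsProbabilityMeasure (μ i)] {s : Set ℝ} (hμ : ∀ i, ∀ᵐ x ∂μ i, x ∈ s) :
    ∀ᵐ x ∂Measure.pi μ, ∀ i, x i ∈ s :=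
  ae_all_iff.2 fun i => (Measure.tendsto_eval_ae_ae (μ := μ) (i := i)).eventually (hμ i)

theorem lintegral_pi_succ {n : ℕ} (μ : Fin (n + 1) → Measure ℝ)
    [∀ i, IsProbabilityMeasure (μ i)] {g : (Fin (n + 1) → ℝ) → ℝ≥0∞} (hg : Measurable g) :
    ∫⁻ x, g x ∂Measure.pi μ =
      ∫⁻ s, ∫⁻ x, g (Fin.cons s x) ∂Measure.pi (fun i => μ i.succ) ∂μ 0 := by
  have h := (measurePreserving_piFinSuccAbove μ 0).symm
  rw [← h.lintegral_comp hg, lintegral_prod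
    (fun a => g ((MeasurableEquiv.piFinSuccAbove (fun _ => ℝ) 0).symm a))
    (hg.comp h.measurable).aemeasurable]
  refine lintegral_congr fun s => lintegral_congr fun x => congrArg g ?_
  simp [Fin.insertNthEquiv]

/-- Integrals of exponentials of convex functions are log-convex. -/
theorem convexOn_log_lintegral_exp {α : Type*} [MeasurableSpace α] (π : Measure α) {h : ℝ → α → ℝ}
    (hm : ∀ r, Measurable (h r)) (hc : ∀ x, ConvexOn ℝ Set.univ fun r => h r x)
    (h0 : ∀ r, ∫⁻ x, ENNReal.ofReal (Real.exp (h r x)) ∂π ≠ 0)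
    (htop : ∀ r, ∫⁻ x, ENNReal.ofReal (Real.exp (h r x)) ∂π ≠ ∞) :
    ConvexOn ℝ Set.univ fun r =>
      Real.log (∫⁻ x, ENNReal.ofReal (Real.exp (h r x)) ∂π).toReal := by
  set W := fun r => ∫⁻ x, ENNReal.ofReal (Real.exp (h r x)) ∂π with hW
  have hpos : ∀ r, 0 < (W r).toReal := fun r => ENNReal.toReal_pos (h0 r) (htop r)
  refine ⟨convex_univ, fun r _ r' _ a b ha hb hab => ?_⟩
  have key : W (a • r + b • r') ≤ W r ^ a * W r' ^ b := by
    refine le_trans (lintegral_mono fun x => ?_)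
      (ENNReal.lintegral_mul_norm_pow_le (hm r).exp.ennreal_ofReal.aemeasurable
        (hm r').exp.ennreal_ofReal.aemeasurable ha hb hab)
    rw [ENNReal.ofReal_rpow_of_pos (Real.exp_pos _), ENNReal.ofReal_rpow_of_pos (Real.exp_pos _),
      ← Real.exp_mul, ← Real.exp_mul, ← ENNReal.ofReal_mul (Real.exp_pos _).le, ← Real.exp_add]
    refine ENNReal.ofReal_le_ofReal (Real.exp_le_exp.2 ?_)
    have := (hc x).2 (Set.mem_univ r) (Set.mem_univ r') ha hb hab
    simp only [smul_eq_mul] at this ⊢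
    linarith
  have h2 := ENNReal.toReal_mono (ENNReal.mul_ne_top
    (ENNReal.rpow_ne_top_of_nonneg ha (htop r)) (ENNReal.rpow_ne_top_of_nonneg hb (htop r'))) key
  rw [ENNReal.toReal_mul, ← ENNReal.toReal_rpow, ← ENNReal.toReal_rpow] at h2
  refine (Real.log_le_log (hpos _) h2).trans (le_of_eq ?_)
  rw [Real.log_mul (Real.rpow_pos_of_pos (hpos _) _).ne' (Real.rpow_pos_of_pos (hpos _) _).ne',
    Real.log_rpow (hpos _), Real.log_rpow (hpos _)]
  rfl

theorem lintegral_exp_ne_zero {α : Type*} [MeasurableSpace α] (π : Measure α)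
    [IsProbabilityMeasure π] {h : α → ℝ} {b : ℝ} (hb : ∀ x, b ≤ h x) :
    ∫⁻ x, ENNReal.ofReal (Real.exp (h x)) ∂π ≠ 0 := by
  have : ENNReal.ofReal (Real.exp b) ≤ ∫⁻ x, ENNReal.ofReal (Real.exp (h x)) ∂π := by
    calc _ = ∫⁻ _, ENNReal.ofReal (Real.exp b) ∂π := by simp
      _ ≤ _ := lintegral_mono fun x => ENNReal.ofReal_le_ofReal (Real.exp_le_exp.2 (hb x))
  exact ((ENNReal.ofReal_pos.2 (Real.exp_pos b)).trans_le this).ne'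

theorem lintegral_exp_ne_top {α : Type*} [MeasurableSpace α] (π : Measure α)
    [IsProbabilityMeasure π] {h : α → ℝ} {b : ℝ} (hb : ∀ᵐ x ∂π, h x ≤ b) :
    ∫⁻ x, ENNReal.ofReal (Real.exp (h x)) ∂π ≠ ∞ := by
  have : ∫⁻ x, ENNReal.ofReal (Real.exp (h x)) ∂π ≤ ENNReal.ofReal (Real.exp b) := by
    calc _ ≤ ∫⁻ _, ENNReal.ofReal (Real.exp b) ∂π := by
          refine lintegral_mono_ae ?_
          filter_upwards [hb] with x hx
          exact ENNReal.ofReal_le_ofReal (Real.exp_le_exp.2 hx)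
      _ = _ := by simp
  exact (this.trans_lt ENNReal.ofReal_lt_top).ne

theorem exists_bound_on_cube {n : ℕ} (M : ℝ) {f : (Fin n → ℝ) → ℝ} (hf : Continuous f) :
    ∃ B, ∀ x, (∀ i, x i ∈ Set.Icc (-M) M) → |f x| ≤ B := by
  obtain ⟨B, hB⟩ := (isCompact_univ_pi fun _ : Fin n => isCompact_Icc (a := -M) (b := M)
    ).exists_bound_of_continuousOn hf.continuousOn
  exact ⟨B, fun x hx => hB x fun i _ => hx i⟩

/-- Maurey's convex transport inequality for product measures on a cube. -/
theorem lintegral_infConv_mul_le_one {M : ℝ} (hM : 0 < M) :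
    ∀ (n : ℕ) (μ : Fin n → Measure ℝ) [∀ i, IsProbabilityMeasure (μ i)],
      (∀ i, ∀ᵐ x ∂μ i, x ∈ Set.Icc (-M) M) → ∀ (f : (Fin n → ℝ) → ℝ) (b : ℝ),
      (∀ x, b ≤ f x) → ConvexOn ℝ Set.univ f →
      (∫⁻ x, ENNReal.ofReal (Real.exp (infConv (1 / (8 * (2 * M) ^ 2)) f x)) ∂Measure.pi μ) *
        ∫⁻ x, ENNReal.ofReal (Real.exp (-f x)) ∂Measure.pi μ ≤ 1 := by
  have hκ : 0 ≤ 1 / (8 * (2 * M) ^ 2) := by positivity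
  set κ := 1 / (8 * (2 * M) ^ 2) with hκdef
  intro n
  induction n with
  | zero =>
    intro μ _ hμ f b hb hf
    rw [lintegral_unique, lintegral_unique]
    simp only [measure_univ, mul_one]
    rw [← ENNReal.ofReal_mul (Real.exp_pos _).le, ← Real.exp_add, ENNReal.ofReal_le_one,
      Real.exp_le_one_iff]
    exact (sub_eq_add_neg _ _).symm.trans_le (sub_nonpos.2 (infConv_le_self hκ hb _))
  | succ n ih =>
    intro μ _ hμ f b hb hf
    set π := Measure.pi fun i : Fin n => μ i.succ with hπ
    have hfc : Continuous f := hf.continuous_of_univ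
    have hQc : Continuous (infConv κ f) := (convexOn_infConv hκ hb hf).continuous_of_univ
    set h : ℝ → (Fin n → ℝ) → ℝ := fun r => infConv κ fun y => f (Fin.cons r y) with hh
    have hhconv : ∀ r, ConvexOn ℝ Set.univ (h r) := fun r =>
      convexOn_infConv hκ (fun y => hb _) (convexOn_comp_cons hf r)
    have hhm : ∀ r, Measurable (h r) := fun r => (hhconv r).continuous_of_univ.measurable
    set W : ℝ → ℝ≥0∞ := fun r => ∫⁻ x, ENNReal.ofReal (Real.exp (h r x)) ∂π with hW
    have hW0 : ∀ r, W r ≠ 0 := fun r =>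
      lintegral_exp_ne_zero π (le_infConv hκ fun y => hb _)
    have hWtop : ∀ r, W r ≠ ∞ := by
      intro r
      obtain ⟨B, hB⟩ := exists_bound_on_cube M (hhconv r).continuous_of_univ
      refine lintegral_exp_ne_top π (b := B) ?_
      filter_upwards [ae_pi_forall_mem (fun i : Fin n => μ i.succ) fun i => hμ i.succ] with x hx
      exact (abs_le.1 (hB x hx)).2
    -- The one-dimensional inequality is applied to this φ, with the integral of e^{Qf(s, ·)} over
    -- the other coordinates as its `G`.
    set φ : ℝ → ℝ := fun r => Real.log (W r).toReal with hφ
    have hexpφ : ∀ r, Real.exp (φ r) = (W r).toReal := fun r =>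
      Real.exp_log (ENNReal.toReal_pos (hW0 r) (hWtop r))
    have hφc : ConvexOn ℝ Set.univ φ := convexOn_log_lintegral_exp π hhm
      (fun x => convexOn_infConv_cons hκ hb hf x) hW0 hWtop
    have hG : ∀ s r, ∫⁻ x, ENNReal.ofReal (Real.exp (infConv κ f (Fin.cons s x))) ∂π ≤
        ENNReal.ofReal (Real.exp (φ r + (s - r) ^ 2 / (8 * (2 * M) ^ 2))) := by
      intro s r
      calc _ ≤ ∫⁻ x, ENNReal.ofReal (Real.exp (κ * (s - r) ^ 2)) *
              ENNReal.ofReal (Real.exp (h r x)) ∂π := by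
            refine lintegral_mono fun x => ?_
            rw [← ENNReal.ofReal_mul (Real.exp_pos _).le, ← Real.exp_add]
            refine ENNReal.ofReal_le_ofReal (Real.exp_le_exp.2 ?_)
            linarith [infConv_cons_le hκ hb s r x]
        _ = ENNReal.ofReal (Real.exp (κ * (s - r) ^ 2)) * W r :=
            lintegral_const_mul _ (hhm r).exp.ennreal_ofReal
        _ = _ := by
            rw [Real.exp_add, hexpφ, ENNReal.ofReal_mul ENNReal.toReal_nonneg,
              ENNReal.ofReal_toReal (hWtop r), mul_comm, hκdef]
            congr 3
            ring
    -- The induction hypothesis for the slice f(r, ·) bounds its integral by 1/W(r) = e^{-φ(r)}.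
    have hlow : ∀ r, ∫⁻ x, ENNReal.ofReal (Real.exp (-f (Fin.cons r x))) ∂π ≤
        ENNReal.ofReal (Real.exp (-φ r)) := by
      intro r
      have := ih (fun i => μ i.succ) (fun i => hμ i.succ) (fun y => f (Fin.cons r y)) b
        (fun y => hb _) (convexOn_comp_cons hf r)
      rw [Real.exp_neg, hexpφ, ENNReal.ofReal_inv_of_pos (ENNReal.toReal_pos (hW0 r) (hWtop r)),
        ENNReal.ofReal_toReal (hWtop r)]
      rw [mul_comm] at this
      simpa using ENNReal.le_div_iff_mul_le (Or.inl (hW0 r)) (Or.inl (hWtop r)) |>.2 this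
    rw [lintegral_pi_succ μ hQc.measurable.exp.ennreal_ofReal,
      lintegral_pi_succ μ (g := fun x => ENNReal.ofReal (Real.exp (-f x)))
        hfc.measurable.neg.exp.ennreal_ofReal]
    exact (mul_le_mul_right (lintegral_mono hlow) _).trans
      (lintegral_mul_lintegral_exp_neg_le_one hM (μ 0) (hμ 0) hφc hG)

/-! ### Sub-Gaussian concentration for bounded coordinates. -/

theorem norm_toLp_sub {n : ℕ} (x y : Fin n → ℝ) :
    ‖(WithLp.toLp 2 x : EuclideanSpace ℝ (Fin n)) - WithLp.toLp 2 y‖ =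
      Real.sqrt (∑ i, (x i - y i) ^ 2) := by
  rw [EuclideanSpace.norm_eq]
  simp

theorem convexOn_comp_toLp {n : ℕ} {f : EuclideanSpace ℝ (Fin n) → ℝ}
    (hf : ConvexOn ℝ Set.univ f) :
    ConvexOn ℝ Set.univ fun x : Fin n → ℝ => f (WithLp.toLp 2 x) :=
  hf.comp_linearMap (WithLp.linearEquiv 2 ℝ (Fin n → ℝ)).symm.toLinearMap

/-- Completing the square: w²/(8(2M)²) - lw is minimal at w = 4l(2M)², with value -2l²(2M)². -/
theorem sub_le_infConv {n : ℕ} {M l : ℝ} (hM : 0 < M) {F : (Fin n → ℝ) → ℝ}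
    (hF : ∀ x y, F x - F y ≤ l * Real.sqrt (∑ i, (x i - y i) ^ 2)) (x : Fin n → ℝ) :
    F x - 2 * l ^ 2 * (2 * M) ^ 2 ≤ infConv (1 / (8 * (2 * M) ^ 2)) F x := by
  refine le_ciInf fun y => ?_
  have h0 : 0 ≤ ∑ i, (x i - y i) ^ 2 := Finset.sum_nonneg fun i _ => sq_nonneg _
  have h1 := hF x y
  set w := Real.sqrt (∑ i, (x i - y i) ^ 2) with hw
  have h2 : ∑ i, (x i - y i) ^ 2 = w ^ 2 := (Real.sq_sqrt h0).symm
  have h3 : 0 ≤ (w - 4 * l * (2 * M) ^ 2) ^ 2 / (8 * (2 * M) ^ 2) := by positivity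
  have h4 : (w - 4 * l * (2 * M) ^ 2) ^ 2 / (8 * (2 * M) ^ 2) =
      1 / (8 * (2 * M) ^ 2) * w ^ 2 - l * w + 2 * l ^ 2 * (2 * M) ^ 2 := by
    field_simp
    ring
  rw [h2]
  linarith

/-- The product of the exponential moments of a convex Lipschitz function and of its negative, for
a product measure on a cube. -/
theorem lintegral_exp_mul_lintegral_exp_neg_le {n : ℕ} {M l : ℝ} (hM : 0 < M) (hl : 0 ≤ l)
    (μ : Fin n → Measure ℝ) [∀ i, IsProbabilityMeasure (μ i)]
    (hμ : ∀ i, ∀ᵐ x ∂μ i, x ∈ Set.Icc (-M) M) {f : EuclideanSpace ℝ (Fin n) → ℝ}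
    (hf : ConvexOn ℝ Set.univ f) (hL : LipschitzWith 1 f) :
    (∫⁻ x, ENNReal.ofReal (Real.exp (l * f (WithLp.toLp 2 x))) ∂Measure.pi μ) *
      ∫⁻ x, ENNReal.ofReal (Real.exp (-l * f (WithLp.toLp 2 x))) ∂Measure.pi μ ≤
      ENNReal.ofReal (Real.exp (2 * l ^ 2 * (2 * M) ^ 2)) := by
  have hgc : ConvexOn ℝ Set.univ fun x : Fin n → ℝ => l * f (WithLp.toLp 2 x) :=
    (convexOn_comp_toLp hf).smul hl
  obtain ⟨B, hB⟩ := exists_bound_on_cube M hgc.continuous_of_univ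
  -- Cutting off at -B changes nothing on the cube and keeps convexity and the Lipschitz bound,
  -- while providing the lower bound that the infimum convolution requires.
  set F : (Fin n → ℝ) → ℝ := fun x => max (l * f (WithLp.toLp 2 x)) (-B) with hFdef
  have hFb : ∀ x, -B ≤ F x := fun x => le_max_right _ _
  have hFc : ConvexOn ℝ Set.univ F := hgc.sup (convexOn_const _ convex_univ)
  have hFeq : ∀ᵐ x ∂Measure.pi μ, F x = l * f (WithLp.toLp 2 x) := by
    filter_upwards [ae_pi_forall_mem μ hμ] with x hx
    exact max_eq_left (abs_le.1 (hB x hx)).1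
  have hFL : ∀ x y, F x - F y ≤ l * Real.sqrt (∑ i, (x i - y i) ^ 2) := by
    intro x y
    have h1 : f (WithLp.toLp 2 x) - f (WithLp.toLp 2 y) ≤ Real.sqrt (∑ i, (x i - y i) ^ 2) := by
      rw [← norm_toLp_sub, ← dist_eq_norm]
      have := hL.dist_le_mul (WithLp.toLp 2 x) (WithLp.toLp 2 y)
      rw [Real.dist_eq, NNReal.coe_one, one_mul] at this
      exact (le_abs_self _).trans this
    have h2 := mul_le_mul_of_nonneg_left h1 hl
    have h3 : 0 ≤ l * Real.sqrt (∑ i, (x i - y i) ^ 2) := by positivity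
    rw [sub_le_iff_le_add, hFdef]
    refine max_le ?_ ?_
    · have := le_max_left (l * f (WithLp.toLp 2 y)) (-B)
      linarith
    · have := le_max_right (l * f (WithLp.toLp 2 y)) (-B)
      linarith
  have key := lintegral_infConv_mul_le_one hM n μ hμ F (-B) hFb hFc
  have h1 : ∫⁻ x, ENNReal.ofReal (Real.exp (l * f (WithLp.toLp 2 x))) ∂Measure.pi μ ≤
      ENNReal.ofReal (Real.exp (2 * l ^ 2 * (2 * M) ^ 2)) *
      ∫⁻ x, ENNReal.ofReal (Real.exp (infConv (1 / (8 * (2 * M) ^ 2)) F x)) ∂Measure.pi μ := by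
    rw [← lintegral_const_mul' _ _ ENNReal.ofReal_ne_top]
    refine lintegral_mono_ae ?_
    filter_upwards [hFeq] with x hx
    rw [← ENNReal.ofReal_mul (Real.exp_pos _).le, ← Real.exp_add]
    refine ENNReal.ofReal_le_ofReal (Real.exp_le_exp.2 ?_)
    linarith [sub_le_infConv hM hFL x]
  have h2 : ∫⁻ x, ENNReal.ofReal (Real.exp (-l * f (WithLp.toLp 2 x))) ∂Measure.pi μ =
      ∫⁻ x, ENNReal.ofReal (Real.exp (-F x)) ∂Measure.pi μ := by
    refine lintegral_congr_ae ?_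
    filter_upwards [hFeq] with x hx
    rw [hx, neg_mul]
  rw [h2]
  calc _ ≤ _ := mul_le_mul_left h1 _
    _ ≤ _ := by
      rw [mul_assoc]
      exact mul_le_of_le_one_right' key

theorem measurable_randVec {Ω : Type*} [MeasurableSpace Ω] {n : ℕ} {X : Fin n → Ω → ℝ}
    (hX : ∀ i, Measurable (X i)) : Measurable (randVec X) :=
  (WithLp.measurable_toLp 2 (Fin n → ℝ)).comp (measurable_pi_lambda _ hX)

/-- Convex Lipschitz functions of bounded independent variables are sub-Gaussian. -/
theorem hasSubgaussianMGF_of_convexOn_of_lipschitz {Ω : Type*} [MeasurableSpace Ω]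
    (P : Measure Ω) [IsProbabilityMeasure P] {n : ℕ} {X : Fin n → Ω → ℝ} {M : ℝ} (hM : 0 < M)
    (hX : ∀ i, Measurable (X i)) (hind : iIndepFun X P) (hb : ∀ i ω, |X i ω| ≤ M)
    {f : EuclideanSpace ℝ (Fin n) → ℝ} (hf : ConvexOn ℝ Set.univ f) (hL : LipschitzWith 1 f) :
    HasSubgaussianMGF (fun ω => f (randVec X ω) - ∫ ω', f (randVec X ω') ∂P)
      (Real.toNNReal (16 * M ^ 2)) P := by
  set Z : Ω → ℝ := fun ω => f (randVec X ω) with hZ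
  have hZm : Measurable Z := hL.continuous.measurable.comp (measurable_randVec hX)
  obtain ⟨B, hB⟩ := exists_bound_on_cube M (convexOn_comp_toLp hf).continuous_of_univ
  have hZB : ∀ ω, |Z ω| ≤ B := fun ω => hB (fun i => X i ω) fun i => abs_le.1 (hb i ω)
  have hZint : Integrable Z P := Integrable.of_bound hZm.aestronglyMeasurable B (ae_of_all _ hZB)
  have hexpint : ∀ l : ℝ, Integrable (fun ω => Real.exp (l * Z ω)) P := by
    intro l
    refine Integrable.of_bound (by fun_prop) (Real.exp (|l| * B)) (ae_of_all _ fun ω => ?_)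
    rw [Real.norm_of_nonneg (Real.exp_pos _).le]
    refine Real.exp_le_exp.2 ((le_abs_self _).trans ?_)
    rw [abs_mul]
    exact mul_le_mul_of_nonneg_left (hZB ω) (abs_nonneg _)
  have hlint : ∀ l : ℝ, ENNReal.ofReal (mgf Z P l) =
      ∫⁻ x, ENNReal.ofReal (Real.exp (l * f (WithLp.toLp 2 x)))
        ∂Measure.pi fun i => P.map (X i) := by
    intro l
    rw [← (iIndepFun_iff_map_fun_eq_pi_map fun i => (hX i).aemeasurable).1 hind,
      lintegral_map _ (measurable_pi_lambda _ hX), mgf,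
      ofReal_integral_eq_lintegral_ofReal (hexpint l) (ae_of_all _ fun _ => (Real.exp_pos _).le)]
    · rfl
    · exact ((hL.continuous.measurable.comp
        (WithLp.measurable_toLp 2 (Fin n → ℝ))).const_mul l).exp.ennreal_ofReal
  have hpos : ∀ l : ℝ, 0 ≤ l → mgf Z P l * mgf Z P (-l) ≤ Real.exp (8 * l ^ 2 * M ^ 2) := by
    intro l hl
    have hprob : ∀ i, IsProbabilityMeasure (P.map (X i)) := fun i =>
      Measure.isProbabilityMeasure_map (hX i).aemeasurable
    have := lintegral_exp_mul_lintegral_exp_neg_le hM hl (fun i => P.map (X i)) (fun i =>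
      (ae_map_iff (p := fun x => x ∈ Set.Icc (-M) M) (hX i).aemeasurable measurableSet_Icc).2
        (ae_of_all _ fun ω => abs_le.1 (hb i ω))) hf hL
    rw [← hlint, ← hlint, ← ENNReal.ofReal_mul mgf_nonneg,
      ENNReal.ofReal_le_ofReal_iff (Real.exp_pos _).le] at this
    refine this.trans (le_of_eq ?_)
    congr 1
    ring
  -- Convexity of l·f requires l ≥ 0, but the product is symmetric under l ↦ -l.
  have hprod : ∀ l : ℝ, mgf Z P l * mgf Z P (-l) ≤ Real.exp (8 * l ^ 2 * M ^ 2) := by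
    intro l
    rcases le_total 0 l with hl | hl
    · exact hpos l hl
    · have := hpos (-l) (neg_nonneg.2 hl)
      rwa [neg_neg, neg_sq, mul_comm (mgf Z P (-l))] at this
  have hjensen : ∀ l : ℝ, Real.exp (l * ∫ ω, Z ω ∂P) ≤ mgf Z P l := by
    intro l
    rw [← integral_const_mul]
    exact convexOn_exp.map_integral_le Real.continuous_exp.continuousOn isClosed_univ
      (ae_of_all _ fun _ => Set.mem_univ _) (hZint.const_mul l) (hexpint l)
  have hsplit : ∀ l ω, Real.exp (l * (Z ω - ∫ ω', Z ω' ∂P)) =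
      Real.exp (-l * ∫ ω', Z ω' ∂P) * Real.exp (l * Z ω) := by
    intro l ω
    rw [← Real.exp_add]
    congr 1
    ring
  refine ⟨fun l => ((hexpint l).const_mul _).congr (ae_of_all _ fun ω => (hsplit l ω).symm),
    fun l => ?_⟩
  rw [mgf, integral_congr_ae (ae_of_all _ (hsplit l)), integral_const_mul,
    Real.coe_toNNReal _ (by positivity)]
  -- Jensen replaces e^{-l E Z} by E e^{-lZ}, so the product bound controls the centered moment;
  -- 8l²M² = (16M²)l²/2 gives the proxy.
  calc _ ≤ mgf Z P (-l) * mgf Z P l := mul_le_mul_of_nonneg_right (hjensen (-l)) mgf_nonneg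
    _ ≤ Real.exp (8 * l ^ 2 * M ^ 2) := by rw [mul_comm]; exact hprod l
    _ = _ := by congr 1; ring

theorem measure_abs_ge_le_of_hasSubgaussianMGF {Ω : Type*} [MeasurableSpace Ω] {P : Measure Ω}
    [IsFiniteMeasure P] {Z : Ω → ℝ} {c : NNReal} (h : HasSubgaussianMGF Z c P) {t : ℝ} (ht : 0 ≤ t) :
    P.real {ω | t ≤ |Z ω|} ≤ 2 * Real.exp (-t ^ 2 / (2 * c)) := by
  have h1 : {ω | t ≤ |Z ω|} = {ω | t ≤ Z ω} ∪ {ω | t ≤ (-Z) ω} := by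
    ext ω
    simp [le_abs]
  rw [h1, two_mul]
  exact (measureReal_union_le _ _).trans (add_le_add (h.measure_ge_le ht) (h.neg.measure_ge_le ht))

/-! ### Large coordinates and the maximum. -/

section MaxAbs

variable {Ω : Type*} {N : ℕ} {X : Fin N → Ω → ℝ}

theorem abs_le_maxAbs (X : Fin N → Ω → ℝ) (i : Fin N) (ω : Ω) : |X i ω| ≤ maxAbs X ω :=
  le_ciSup (f := fun i => |X i ω|) (Set.finite_range _).bddAbove i

theorem maxAbs_nonneg (X : Fin N → Ω → ℝ) (ω : Ω) : 0 ≤ maxAbs X ω :=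
  Real.iSup_nonneg fun _ => abs_nonneg _

theorem measurable_maxAbs [MeasurableSpace Ω] (hX : ∀ i, Measurable (X i)) :
    Measurable (maxAbs X) :=
  Measurable.iSup fun i => (hX i).abs

/-- A coordinate that is the only one to exceed the level `M` in absolute value
realizes the maximum. -/
theorem maxAbs_eq_of_forall_ne {M : ℝ} {i : Fin N} {ω : Ω} (hi : M < |X i ω|)
    (h : ∀ j ≠ i, |X j ω| ≤ M) : maxAbs X ω = |X i ω| := by
  have : Nonempty (Fin N) := ⟨i⟩
  refine le_antisymm (ciSup_le fun j => ?_) (abs_le_maxAbs X i ω)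
  by_cases hj : j = i
  · rw [hj]
  · exact (h j hj).trans hi.le

/-- If no coordinate exceeds `M` with probability at least `1 / 2`, then the sum of the truncated
moments of the coordinates is controlled by the moment of the maximum. -/
theorem sum_lintegral_ite_lt_abs_le [MeasurableSpace Ω] {μ : Measure Ω} [IsProbabilityMeasure μ]
    (hX : ∀ i, Measurable (X i)) (hind : iIndepFun X μ) {M : ℝ}
    (hM : 1 / 2 ≤ μ {ω | maxAbs X ω ≤ M}) {H : ℝ → ℝ≥0∞} (hH : Measurable H) :
    ∑ i, ∫⁻ ω, (if M < |X i ω| then H |X i ω| else 0) ∂μ ≤ 2 * ∫⁻ ω, H (maxAbs X ω) ∂μ := by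
  classical
  set u : ℝ → ℝ≥0∞ := fun x => if M < |x| then H |x| else 0 with hu
  have hum : Measurable u := by
    refine Measurable.ite (measurableSet_lt measurable_const measurable_id.abs) ?_ measurable_const
    exact hH.comp measurable_id.abs
  -- The event that all other coordinates are at most M is independent of X_i and has probability at
  -- least 1/2. The events {|X_i| > M} ∩ A_i are disjoint, and on each the maximum equals |X_i|.
  set A : Fin N → Set Ω := fun i => {ω | ∀ j ≠ i, |X j ω| ≤ M} with hA
  have hAm : ∀ i, MeasurableSet (A i) := by
    intro i
    have : A i = ⋂ j, ⋂ _ : j ≠ i, {ω | |X j ω| ≤ M} := by ext; simp [hA]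
    rw [this]
    exact MeasurableSet.iInter fun j => MeasurableSet.iInter fun _ =>
      measurableSet_le (hX j).abs measurable_const
  have h1 : ∀ i, (∫⁻ ω, u (X i ω) ∂μ) * (1 / 2) ≤
      ∫⁻ ω, u (X i ω) * (A i).indicator (fun _ => 1) ω ∂μ := by
    intro i
    have hi := hind.indepFun_finset {i} (Finset.univ.erase i) (by simp) hX
    have hindep : IndepFun (fun ω => u (X i ω)) ((A i).indicator (fun _ => (1 : ℝ≥0∞))) μ := by
      set T : Set (↥(Finset.univ.erase i) → ℝ) := {y | ∀ j, |y j| ≤ M} with hTdef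
      have hT : MeasurableSet T := by
        have : T = ⋂ j, {y | |y j| ≤ M} := by ext; simp [hTdef]
        rw [this]
        exact MeasurableSet.iInter fun j =>
          measurableSet_le (measurable_pi_apply j).abs measurable_const
      have hφ : Measurable fun y : ↥({i} : Finset (Fin N)) → ℝ =>
          u (y ⟨i, Finset.mem_singleton_self i⟩) := hum.comp (measurable_pi_apply _)
      have := hi.comp hφ (measurable_const.indicator hT : Measurable (T.indicator fun _ => (1 : ℝ≥0∞)))
      have heq : (A i).indicator (fun _ => (1 : ℝ≥0∞)) =
          (T.indicator fun _ => (1 : ℝ≥0∞)) ∘ fun ω (j : ↥(Finset.univ.erase i)) => X j ω := by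
        ext ω
        simp [Set.indicator, hA, hTdef]
      rw [heq]
      exact this
    rw [lintegral_mul_eq_lintegral_mul_lintegral_of_indepFun''
      (f := fun ω => u (X i ω)) (hum.comp (hX i)).aemeasurable
      (measurable_const.indicator (hAm i)).aemeasurable hindep]
    refine mul_le_mul_right ?_ _
    rw [lintegral_indicator_const (hAm i), one_mul]
    refine hM.trans (measure_mono fun ω hω j _ => ?_)
    exact (abs_le_maxAbs X j ω).trans hω
  have h2 : ∀ ω, ∑ i, u (X i ω) * (A i).indicator (fun _ => 1) ω ≤ H (maxAbs X ω) := by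
    intro ω
    by_cases h : ∃ i, M < |X i ω| ∧ ω ∈ A i
    · obtain ⟨i, hi, hiA⟩ := h
      rw [Finset.sum_eq_single i]
      · simp [hu, hi, hiA, maxAbs_eq_of_forall_ne hi hiA]
      · intro j _ hj
        have : ¬ M < |X j ω| := not_lt.2 (hiA j hj)
        simp [hu, this]
      · simp
    · push Not at h
      rw [Finset.sum_eq_zero]
      · exact zero_le
      · intro i _
        by_cases hi : M < |X i ω|
        · simp [h i hi]
        · simp [hu, hi]
  have h3 : (∑ i, ∫⁻ ω, u (X i ω) ∂μ) * (1 / 2) ≤ ∫⁻ ω, H (maxAbs X ω) ∂μ := by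
    rw [Finset.sum_mul]
    refine (Finset.sum_le_sum fun i _ => h1 i).trans ?_
    rw [← lintegral_finsetSum]
    · exact lintegral_mono h2
    · exact fun i _ => (hum.comp (hX i)).mul (measurable_const.indicator (hAm i))
  calc ∑ i, ∫⁻ ω, u (X i ω) ∂μ = 2 * ((∑ i, ∫⁻ ω, u (X i ω) ∂μ) * (1 / 2)) := by
        rw [mul_comm, mul_assoc, one_div, ENNReal.inv_mul_cancel (by simp) (by simp), mul_one]
    _ ≤ _ := mul_le_mul_right h3 _

end MaxAbs

/-! ### Orlicz functions, (HJ) and the tail of the large coordinates. -/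

namespace IsOrlicz

variable {Ψ : ℝ → ℝ}

theorem nonneg (h : IsOrlicz Ψ) {x : ℝ} (hx : 0 ≤ x) : 0 ≤ Ψ x := by
  have := h.strictMonoOn.monotoneOn (Set.mem_Ici.2 le_rfl) (Set.mem_Ici.2 hx) hx
  rwa [h.map_zero] at this

theorem mono (h : IsOrlicz Ψ) {x y : ℝ} (hx : 0 ≤ x) (hxy : x ≤ y) : Ψ x ≤ Ψ y :=
  h.strictMonoOn.monotoneOn (Set.mem_Ici.2 hx) (Set.mem_Ici.2 (hx.trans hxy)) hxy

theorem map_mul_le (h : IsOrlicz Ψ) {θ x : ℝ} (h0 : 0 ≤ θ) (h1 : θ ≤ 1) (hx : 0 ≤ x) :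
    Ψ (θ * x) ≤ θ * Ψ x := by
  have := h.convexOn.2 (Set.mem_Ici.2 hx) (Set.mem_Ici.2 le_rfl) h0 (sub_nonneg.2 h1) (by ring)
  simpa [h.map_zero] using this

theorem exp_orliczExponent (h : IsOrlicz Ψ) {x : ℝ} (hx : 0 ≤ x) :
    Real.exp (orliczExponent Ψ x) = 1 + Ψ x :=
  Real.exp_log (by linarith [h.nonneg hx])

theorem orliczExponent_nonneg (h : IsOrlicz Ψ) {x : ℝ} (hx : 0 ≤ x) : 0 ≤ orliczExponent Ψ x :=
  Real.log_nonneg (by linarith [h.nonneg hx])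

theorem orliczExponent_mono (h : IsOrlicz Ψ) {x y : ℝ} (hx : 0 ≤ x) (hxy : x ≤ y) :
    orliczExponent Ψ x ≤ orliczExponent Ψ y :=
  Real.log_le_log (by linarith [h.nonneg hx]) (by linarith [h.mono hx hxy])

end IsOrlicz

theorem SatisfiesHJ.exists_one_le {Ψ : ℝ → ℝ} (h : IsOrlicz Ψ) (hHJ : SatisfiesHJ Ψ) :
    ∃ K : ℝ, 1 ≤ K ∧ ∀ s u : ℝ, K ≤ s → K ≤ u →
      orliczExponent Ψ (s * u) ≤ K * (s * Real.log (1 + s) + s * orliczExponent Ψ u) := by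
  obtain ⟨K, hK, H⟩ := hHJ
  refine ⟨max K 1, le_max_right _ _, fun s u hs hu => ?_⟩
  have hs0 : 0 < s := hK.trans_le ((le_max_left _ _).trans hs)
  have hu0 : 0 < u := hK.trans_le ((le_max_left _ _).trans hu)
  refine (H s u ((le_max_left _ _).trans hs) ((le_max_left _ _).trans hu)).trans ?_
  refine mul_le_mul_of_nonneg_right (le_max_left _ _) ?_
  have h1 : 0 ≤ Real.log (1 + s) := Real.log_nonneg (by linarith)
  have h2 := h.orliczExponent_nonneg hu0.le
  positivity

/-- Condition (HJ) bounds the truncated exponential `exp (λ z)`, `z ≤ v`, by `Ψ`, where `λ` is of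
order `ψ v / v`. -/
theorem exp_sub_one_le_of_HJ {Ψ : ℝ → ℝ} (h : IsOrlicz Ψ) {K : ℝ} (hK : 1 ≤ K)
    (H : ∀ s u : ℝ, K ≤ s → K ≤ u →
      orliczExponent Ψ (s * u) ≤ K * (s * Real.log (1 + s) + s * orliczExponent Ψ u))
    {v z : ℝ} (hv : K ^ 2 ≤ v) (hz : 0 ≤ z) (hzv : z ≤ v) :
    Real.exp (orliczExponent Ψ v / (K ^ 2 * v) * z) - 1 ≤
      2 * Real.exp (Real.log (1 + K) + orliczExponent Ψ K) * orliczExponent Ψ v * (1 + Ψ z) := by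
  have hK0 : 0 < K := by linarith
  have hKK : K ≤ K ^ 2 := by nlinarith
  have hv0 : 0 < v := by linarith
  set C := Real.log (1 + K) + orliczExponent Ψ K with hC
  have hlogK : 0 ≤ Real.log (1 + K) := Real.log_nonneg (by linarith)
  have hψK := h.orliczExponent_nonneg hK0.le
  have hψv := h.orliczExponent_nonneg hv0.le
  have hψz := h.orliczExponent_nonneg hz
  rcases hz.eq_or_lt with rfl | hz0
  · have := h.nonneg (le_refl 0)
    simp only [mul_zero, Real.exp_zero, sub_self]
    positivity
  set s := v / z with hs
  have hs1 : 1 ≤ s := (one_le_div hz0).2 hzv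
  have hsz : s * z = v := by rw [hs]; field_simp
  have hlogs : 0 ≤ Real.log (1 + s) := Real.log_nonneg (by linarith)
  set x := orliczExponent Ψ v / (K ^ 2 * v) * z with hx
  have hxs : x = orliczExponent Ψ v / (K ^ 2 * s) := by rw [hx, hs]; field_simp
  have hx0 : 0 ≤ x := by rw [hxs]; positivity
  -- (HJ) is applied to v = s·z when both factors are at least K, to v = K·(v/K) when s < K (then
  -- v/K ≤ z), and to v = (v/K)·K when z < K (then v/K ≤ s). The assumption v ≥ K² makes v/K
  -- admissible.
  have key : x ≤ Real.log (1 + s) + orliczExponent Ψ z + C := by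
    rcases le_or_gt K z with hzK | hzK
    · rcases le_or_gt K s with hsK | hsK
      · have h1 := H s z hsK hzK
        rw [hsz] at h1
        have h2 : x ≤ Real.log (1 + s) + orliczExponent Ψ z := by
          rw [hxs, div_le_iff₀ (by positivity)]
          refine h1.trans ?_
          have : 0 ≤ s * (Real.log (1 + s) + orliczExponent Ψ z) := by positivity
          nlinarith
        linarith
      · have h1 : K ≤ v / K := by rw [le_div_iff₀ hK0]; nlinarith
        have h2 := H K (v / K) le_rfl h1
        rw [mul_div_cancel₀ _ hK0.ne'] at h2
        have h3 : v / K ≤ z := by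
          rw [div_le_iff₀ hK0, ← hsz]; nlinarith
        have h4 := h.orliczExponent_mono (by positivity) h3
        have h5 : x ≤ Real.log (1 + K) + orliczExponent Ψ z := by
          rw [hxs, div_le_iff₀ (by positivity)]
          have h6 : 0 ≤ Real.log (1 + K) + orliczExponent Ψ z := by positivity
          calc _ ≤ _ := h2
            _ ≤ K * (K * Real.log (1 + K) + K * orliczExponent Ψ z) := by gcongr
            _ = (Real.log (1 + K) + orliczExponent Ψ z) * (K ^ 2 * 1) := by ring
            _ ≤ _ := by gcongr
        linarith
    · have h1 : K ≤ v / K := by rw [le_div_iff₀ hK0]; nlinarith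
      have h2 := H (v / K) K h1 le_rfl
      rw [div_mul_cancel₀ _ hK0.ne'] at h2
      have h3 : v / K ≤ s := by rw [hs]; gcongr
      have h4 : Real.log (1 + v / K) ≤ Real.log (1 + s) := Real.log_le_log (by positivity) (by gcongr)
      have h5 : orliczExponent Ψ v ≤ v * (Real.log (1 + s) + orliczExponent Ψ K) := by
        calc _ ≤ _ := h2
          _ = v * (Real.log (1 + v / K) + orliczExponent Ψ K) := by field_simp
          _ ≤ _ := by gcongr
      have h6 : x ≤ Real.log (1 + s) + orliczExponent Ψ K := by
        rw [hxs, div_le_iff₀ (by positivity)]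
        have h7 : v ≤ K ^ 2 * s := by rw [← hsz]; nlinarith
        have h8 : 0 ≤ Real.log (1 + s) + orliczExponent Ψ K := by positivity
        nlinarith
      linarith
  -- The extra factor x = ψ(v)/(K²s) compensates the 1 + s produced by exponentiating log(1 + s).
  have hbase : Real.exp x - 1 ≤ x * Real.exp x := by
    have h1 : Real.exp x * (1 - x) ≤ 1 := by
      have h2 := Real.add_one_le_exp (-x)
      have h3 : Real.exp x * Real.exp (-x) = 1 := by rw [← Real.exp_add]; simp
      nlinarith [Real.exp_pos x]
    linarith
  have hexp : Real.exp x ≤ (1 + s) * (1 + Ψ z) * Real.exp C := by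
    refine (Real.exp_le_exp.2 key).trans (le_of_eq ?_)
    rw [Real.exp_add, Real.exp_add, Real.exp_log (by linarith), h.exp_orliczExponent hz]
  have hxs' : x * (1 + s) ≤ 2 * orliczExponent Ψ v := by
    rw [hxs, div_mul_eq_mul_div, div_le_iff₀ (by positivity)]
    have : 1 + s ≤ 2 * (K ^ 2 * s) := by nlinarith
    nlinarith
  have hΨz := h.nonneg hz
  calc _ ≤ x * Real.exp x := hbase
    _ ≤ x * ((1 + s) * (1 + Ψ z) * Real.exp C) := by gcongr
    _ = (x * (1 + s)) * ((1 + Ψ z) * Real.exp C) := by ring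
    _ ≤ 2 * orliczExponent Ψ v * ((1 + Ψ z) * Real.exp C) := by gcongr
    _ = _ := by ring

/-- Markov's inequality for 1 + Ψ(Y), whose mean is at most 2. -/
theorem measureReal_lt_le_two_div {Ω : Type*} [MeasurableSpace Ω] {μ : Measure Ω}
    [IsProbabilityMeasure μ] {Ψ : ℝ → ℝ} (h : IsOrlicz Ψ) {Y : Ω → ℝ} (hY : Measurable Y)
    (h1 : ∫⁻ ω, ENNReal.ofReal (Ψ (Y ω)) ∂μ ≤ 1) {v : ℝ} (hv : 0 ≤ v) :
    μ.real {ω | v < Y ω} ≤ 2 / (1 + Ψ v) := by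
  have hm : MeasurableSet {ω | v < Y ω} := measurableSet_lt measurable_const hY
  have hΨ := h.nonneg hv
  have h2 : ENNReal.ofReal (1 + Ψ v) * μ {ω | v < Y ω} ≤ 2 := by
    calc _ = ∫⁻ ω, {ω | v < Y ω}.indicator (fun _ => ENNReal.ofReal (1 + Ψ v)) ω ∂μ := by
          rw [lintegral_indicator_const hm]
      _ ≤ ∫⁻ ω, (1 + ENNReal.ofReal (Ψ (Y ω))) ∂μ := by
          refine lintegral_mono fun ω => ?_
          by_cases hω : v < Y ω
          · simp only [Set.indicator, Set.mem_ofPred_eq, hω, if_true]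
            rw [ENNReal.ofReal_add zero_le_one hΨ, ENNReal.ofReal_one]
            gcongr
            exact h.mono hv hω.le
          · simp [Set.indicator, hω]
      _ = 1 + ∫⁻ ω, ENNReal.ofReal (Ψ (Y ω)) ∂μ := by
          rw [lintegral_add_left measurable_const]; simp
      _ ≤ 1 + 1 := by gcongr
      _ = 2 := one_add_one_eq_two
  have h3 := ENNReal.toReal_mono (by simp) h2
  rw [ENNReal.toReal_mul, ENNReal.toReal_ofReal (by linarith), ENNReal.toReal_ofNat] at h3
  rw [le_div_iff₀ (by linarith), mul_comm]
  exact h3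

/-- Hoffmann-Jørgensen type tail bound for the sum of the squares of the large coordinates. -/
theorem exists_tail_bound_sum_sq {Ψ : ℝ → ℝ} (h : IsOrlicz Ψ) (hHJ : SatisfiesHJ Ψ) :
    ∃ γ B : ℝ, 0 < γ ∧ 1 ≤ B ∧ ∀ {Ω : Type*} [MeasurableSpace Ω] (μ : Measure Ω)
      [IsProbabilityMeasure μ] (N : ℕ) (X : Fin N → Ω → ℝ), (∀ i, Measurable (X i)) →
      iIndepFun X μ → ∀ a M : ℝ, ∫⁻ ω, ENNReal.ofReal (Ψ ((maxAbs X ω / a) ^ 2)) ∂μ ≤ 1 →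
      1 / 2 ≤ μ {ω | maxAbs X ω ≤ M} → ∀ t : ℝ, 0 ≤ t →
      μ.real {ω | t < ∑ i, if M < |X i ω| then (X i ω / a) ^ 2 else 0} ≤ B / (1 + Ψ (γ * t)) := by
  obtain ⟨K, hK, H⟩ := hHJ.exists_one_le h
  have hK0 : 0 < K := by linarith
  set C := 2 * Real.exp (Real.log (1 + K) + orliczExponent Ψ K) with hC
  have hC0 : 0 < C := by positivity
  -- With v = γt the Chernoff exponent -λt + 4Cψ(v) is exactly -ψ(v). In B, the 3 adds 1 from
  -- Chernoff and 2 from the maximum; Ψ(K²) makes the bound trivial for v < K².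
  refine ⟨1 / (K ^ 2 * (1 + 4 * C)), 3 + Ψ (K ^ 2), by positivity,
    by linarith [h.nonneg (sq_nonneg K)], ?_⟩
  intro Ω _ μ _ N X hX hind a M hΨ hM t ht
  set v := 1 / (K ^ 2 * (1 + 4 * C)) * t with hv
  have htv : t = K ^ 2 * (1 + 4 * C) * v := by rw [hv]; field_simp
  have hv0 : 0 ≤ v := by positivity
  have hΨv := h.nonneg hv0
  rcases le_or_gt (K ^ 2) v with hKv | hKv
  swap
  · have h1 : Ψ v ≤ Ψ (K ^ 2) := h.mono hv0 hKv.le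
    refine measureReal_le_one.trans ?_
    rw [one_le_div (by linarith)]
    linarith
  have hvpos : 0 < v := lt_of_lt_of_le (by positivity) hKv
  set l := orliczExponent Ψ v / (K ^ 2 * v) with hl
  have hψv := h.orliczExponent_nonneg hv0
  have hl0 : 0 ≤ l := by positivity
  -- Squares above v are dropped, which keeps exponential moments finite; they matter only when the
  -- maximum itself is large.
  set w : ℝ → ℝ := fun x => if M < |x| ∧ (x / a) ^ 2 ≤ v then (x / a) ^ 2 else 0 with hw
  have hwm : Measurable w := by
    refine Measurable.ite ?_ (by fun_prop) measurable_const
    exact (measurableSet_lt measurable_const measurable_id.abs).inter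
      (measurableSet_le ((measurable_id.div_const a).pow_const 2) measurable_const)
  have hw0 : ∀ x, 0 ≤ w x := by
    intro x
    simp only [hw]
    split_ifs <;> positivity
  have hwv : ∀ x, w x ≤ v := by
    intro x
    simp only [hw]
    split_ifs with hx
    · exact hx.2
    · exact hv0
  set W : Fin N → Ω → ℝ := fun i ω => w (X i ω) with hW
  have hWm : ∀ i, Measurable (W i) := fun i => hwm.comp (hX i)
  have hWind : iIndepFun W μ := hind.comp (fun _ => w) fun _ => hwm
  have hexpint : ∀ i, Integrable (fun ω => Real.exp (l * W i ω)) μ := by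
    intro i
    have := hWm i
    refine Integrable.of_bound (by fun_prop) (Real.exp (l * v)) (ae_of_all _ fun ω => ?_)
    rw [Real.norm_of_nonneg (Real.exp_pos _).le]
    exact Real.exp_le_exp.2 (mul_le_mul_of_nonneg_left (hwv _) hl0)
  set E : Fin N → ℝ := fun i => ∫ ω, (Real.exp (l * W i ω) - 1) ∂μ with hE
  have hE0 : ∀ i ω, 0 ≤ Real.exp (l * W i ω) - 1 := fun i ω =>
    sub_nonneg.2 (Real.one_le_exp (mul_nonneg hl0 (hw0 _)))
  have hmgf : ∀ i, mgf (W i) μ l ≤ Real.exp (E i) := by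
    intro i
    have : mgf (W i) μ l = E i + 1 := by
      simp only [hE]
      rw [integral_sub (hexpint i) (integrable_const _)]
      simp [mgf]
    rw [this]
    exact Real.add_one_le_exp _
  -- One factor 2 comes from comparing the sum with the maximum, the other from E(1 + Ψ) ≤ 2.
  have hsumE : ∑ i, E i ≤ 4 * C * orliczExponent Ψ v := by
    set G : ℝ → ℝ≥0∞ := fun y =>
      if (y / a) ^ 2 ≤ v then ENNReal.ofReal (Real.exp (l * (y / a) ^ 2) - 1) else 0 with hG
    have hGm : Measurable G :=
      Measurable.ite (measurableSet_le (by fun_prop) measurable_const) (by fun_prop)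
        measurable_const
    have h1 := sum_lintegral_ite_lt_abs_le hX hind hM hGm
    have h2 : ∀ i, ENNReal.ofReal (E i) =
        ∫⁻ ω, (if M < |X i ω| then G |X i ω| else 0) ∂μ := by
      intro i
      simp only [hE]
      rw [ofReal_integral_eq_lintegral_ofReal (f := fun ω => Real.exp (l * W i ω) - 1)
        ((hexpint i).sub (integrable_const _)) (ae_of_all _ (hE0 i))]
      refine lintegral_congr fun ω => ?_
      simp only [hW, hw, hG, div_pow, sq_abs]
      by_cases hi : M < |X i ω| <;> by_cases hi' : X i ω ^ 2 / a ^ 2 ≤ v <;> simp [hi, hi']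
    have h3 : ∫⁻ ω, G (maxAbs X ω) ∂μ ≤ ENNReal.ofReal (C * orliczExponent Ψ v) * 2 := by
      calc _ ≤ ∫⁻ ω, ENNReal.ofReal (C * orliczExponent Ψ v) *
              (1 + ENNReal.ofReal (Ψ ((maxAbs X ω / a) ^ 2))) ∂μ := by
            refine lintegral_mono fun ω => ?_
            simp only [hG]
            split_ifs with hω
            · have hp := h.nonneg (sq_nonneg (maxAbs X ω / a))
              rw [← ENNReal.ofReal_one, ← ENNReal.ofReal_add zero_le_one hp,
                ← ENNReal.ofReal_mul (by positivity)]
              exact ENNReal.ofReal_le_ofReal (exp_sub_one_le_of_HJ h hK H hKv (sq_nonneg _) hω)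
            · exact zero_le
        _ = ENNReal.ofReal (C * orliczExponent Ψ v) *
              (1 + ∫⁻ ω, ENNReal.ofReal (Ψ ((maxAbs X ω / a) ^ 2)) ∂μ) := by
            rw [lintegral_const_mul' _ _ ENNReal.ofReal_ne_top, lintegral_add_left measurable_const]
            simp
        _ ≤ ENNReal.ofReal (C * orliczExponent Ψ v) * (1 + 1) := by gcongr
        _ = _ := by rw [one_add_one_eq_two]
    have h4 : ENNReal.ofReal (∑ i, E i) ≤ ENNReal.ofReal (4 * C * orliczExponent Ψ v) := by
      rw [ENNReal.ofReal_sum_of_nonneg fun i _ => integral_nonneg (hE0 i),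
        Finset.sum_congr rfl fun i _ => h2 i]
      refine h1.trans ((mul_le_mul_right h3 2).trans (le_of_eq ?_))
      rw [show (4 * C * orliczExponent Ψ v) = 2 * (C * orliczExponent Ψ v * 2) by ring,
        ENNReal.ofReal_mul zero_le_two, ENNReal.ofReal_mul (q := 2) (by positivity),
        ENNReal.ofReal_ofNat]
    exact (ENNReal.ofReal_le_ofReal_iff (by positivity)).1 h4
  have hchern : μ.real {ω | t ≤ (∑ i, W i) ω} ≤ 1 / (1 + Ψ v) := by
    have hint : Integrable (fun ω => Real.exp (l * (∑ i, W i) ω)) μ :=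
      hWind.integrable_exp_mul_sum hWm fun i _ => hexpint i
    refine (measure_ge_le_exp_mul_mgf t hl0 hint).trans ?_
    rw [hWind.mgf_sum hWm]
    have h1 : ∏ i, mgf (W i) μ l ≤ Real.exp (∑ i, E i) := by
      rw [Real.exp_sum]
      exact Finset.prod_le_prod (fun _ _ => mgf_nonneg) fun i _ => hmgf i
    have h2 : -l * t = -(1 + 4 * C) * orliczExponent Ψ v := by
      rw [htv, hl]; field_simp
    calc _ ≤ Real.exp (-l * t) * Real.exp (4 * C * orliczExponent Ψ v) :=
          mul_le_mul_of_nonneg_left (h1.trans (Real.exp_le_exp.2 hsumE)) (Real.exp_pos _).le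
      _ = Real.exp (-orliczExponent Ψ v) := by
          rw [← Real.exp_add, h2]; congr 1; ring
      _ = _ := by rw [Real.exp_neg, h.exp_orliczExponent hv0, one_div]
  have hmax : μ.real {ω | v < (maxAbs X ω / a) ^ 2} ≤ 2 / (1 + Ψ v) :=
    measureReal_lt_le_two_div h (((measurable_maxAbs hX).div_const a).pow_const 2) hΨ hv0
  have hsub : {ω | t < ∑ i, if M < |X i ω| then (X i ω / a) ^ 2 else 0} ⊆
      {ω | t ≤ (∑ i, W i) ω} ∪ {ω | v < (maxAbs X ω / a) ^ 2} := by
    intro ω hω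
    by_cases hω' : v < (maxAbs X ω / a) ^ 2
    · exact Or.inr hω'
    · left
      rw [Set.mem_ofPred_eq] at hω ⊢
      rw [Finset.sum_apply]
      refine hω.le.trans (le_of_eq (Finset.sum_congr rfl fun i _ => ?_))
      have : (X i ω / a) ^ 2 ≤ v := by
        refine le_trans ?_ (not_lt.1 hω')
        rw [div_pow, div_pow, ← sq_abs (X i ω)]
        have := abs_le_maxAbs X i ω
        gcongr
      simp [hW, hw, this]
  calc _ ≤ _ := measureReal_mono hsub
    _ ≤ _ := measureReal_union_le _ _
    _ ≤ 1 / (1 + Ψ v) + 2 / (1 + Ψ v) := add_le_add hchern hmax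
    _ ≤ _ := by
      rw [← add_div]
      have := h.nonneg (sq_nonneg K)
      exact div_le_div_of_nonneg_right (by linarith) (by linarith)

/-! ### Truncation at twice the mean of the maximum. -/

theorem half_le_measure_maxAbs_le {Ω : Type*} [MeasurableSpace Ω] {μ : Measure Ω}
    [IsProbabilityMeasure μ] {N : ℕ} {X : Fin N → Ω → ℝ} (hX : ∀ i, Measurable (X i))
    (hint : Integrable (maxAbs X) μ) (hm : 0 < ∫ ω, maxAbs X ω ∂μ) :
    1 / 2 ≤ μ {ω | maxAbs X ω ≤ 2 * ∫ ω', maxAbs X ω' ∂μ} := by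
  set m := ∫ ω, maxAbs X ω ∂μ with hmdef
  have h1 := mul_meas_ge_le_integral_of_nonneg (ae_of_all _ (maxAbs_nonneg X)) hint (2 * m)
  have h2 : μ.real {ω | 2 * m ≤ maxAbs X ω} ≤ 1 / 2 := by
    rw [← hmdef] at h1
    nlinarith
  have h3 : {ω | maxAbs X ω ≤ 2 * m}ᶜ ⊆ {ω | 2 * m ≤ maxAbs X ω} := fun ω hω =>
    (not_le.1 (show ¬ maxAbs X ω ≤ 2 * m from hω)).le
  have h4 := probReal_compl_eq_one_sub (μ := μ)
    (measurableSet_le (measurable_maxAbs hX) (measurable_const (a := 2 * m)))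
  have h5 := measureReal_mono (μ := μ) h3
  have h6 : (1 / 2 : ℝ) ≤ μ.real {ω | maxAbs X ω ≤ 2 * m} := by linarith
  have h7 := ENNReal.ofReal_le_ofReal h6
  rw [ofReal_measureReal] at h7
  refine le_trans (le_of_eq ?_) h7
  rw [ENNReal.ofReal_div_of_pos zero_lt_two]
  simp

/-- A crude dimension-dependent bound, used only for integrability and for the degenerate case; it
does not enter the constants. -/
theorem norm_le_card_mul_maxAbs {Ω : Type*} {N : ℕ} (X : Fin N → Ω → ℝ) (ω : Ω) :
    ‖randVec X ω‖ ≤ N * maxAbs X ω := by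
  rw [EuclideanSpace.norm_eq, Real.sqrt_le_iff]
  refine ⟨mul_nonneg (Nat.cast_nonneg _) (maxAbs_nonneg X ω), ?_⟩
  calc _ ≤ (∑ i, ‖randVec X ω i‖) ^ 2 := Finset.sum_sq_le_sq_sum_of_nonneg fun i _ => norm_nonneg _
    _ ≤ (∑ _ : Fin N, maxAbs X ω) ^ 2 := by
      gcongr with i
      exact abs_le_maxAbs X i ω
    _ = _ := by simp

theorem integrable_comp_randVec {Ω : Type*} [MeasurableSpace Ω] {μ : Measure Ω}
    [IsProbabilityMeasure μ] {N : ℕ} {X : Fin N → Ω → ℝ} (hX : ∀ i, Measurable (X i))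
    (hint : Integrable (maxAbs X) μ) {f : EuclideanSpace ℝ (Fin N) → ℝ} (hL : LipschitzWith 1 f) :
    Integrable (fun ω => f (randVec X ω)) μ := by
  refine Integrable.mono' ((integrable_const |f 0|).add (hint.const_mul N))
    (hL.continuous.measurable.comp (measurable_randVec hX)).aestronglyMeasurable
    (ae_of_all _ fun ω => ?_)
  have h1 := hL.dist_le_mul (randVec X ω) 0
  rw [NNReal.coe_one, one_mul, dist_zero_right, Real.dist_eq] at h1
  have h2 := abs_sub_abs_le_abs_sub (f (randVec X ω)) (f 0)
  have h3 := norm_le_card_mul_maxAbs X ω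
  simp only [Real.norm_eq_abs, Pi.add_apply]
  linarith

/-- Concentration of a convex Lipschitz function up to the contribution of the large
coordinates. -/
theorem measure_lt_abs_sub_integral_le {Ω : Type*} [MeasurableSpace Ω] {μ : Measure Ω}
    [IsProbabilityMeasure μ] {N : ℕ} {X : Fin N → Ω → ℝ} (hX : ∀ i, Measurable (X i))
    (hind : iIndepFun X μ) (hint : Integrable (maxAbs X) μ) {m : ℝ}
    (hmdef : m = ∫ ω, maxAbs X ω ∂μ) (hm : 0 < m)
    {f : EuclideanSpace ℝ (Fin N) → ℝ} (hf : ConvexOn ℝ Set.univ f) (hL : LipschitzWith 1 f)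
    {a t : ℝ} (ha : 0 < a) (ht : 8 * m ≤ t) :
    μ.real {ω | t < |f (randVec X ω) - ∫ ω', f (randVec X ω') ∂μ|} ≤
      2 * Real.exp (-(t ^ 2 / (2048 * m ^ 2))) +
      μ.real {ω | (t / 2) ^ 2 / a ^ 2 < ∑ i, if 2 * m < |X i ω| then (X i ω / a) ^ 2 else 0} := by
  have hMpos : 0 < 2 * m := by linarith
  set M := 2 * m with hM
  set τ : ℝ → ℝ := fun x => if |x| ≤ M then x else 0 with hτ
  have hτm : Measurable τ :=
    Measurable.ite (measurableSet_le measurable_id.abs measurable_const) measurable_id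
      measurable_const
  have hτM : ∀ x, |τ x| ≤ M := by
    intro x
    simp only [hτ]
    split_ifs with h
    · exact h
    · simpa using hMpos.le
  set X' : Fin N → Ω → ℝ := fun i ω => τ (X i ω) with hX'
  have hX'm : ∀ i, Measurable (X' i) := fun i => hτm.comp (hX i)
  have hind' : iIndepFun X' μ := hind.comp (fun _ => τ) fun _ => hτm
  have hsub := measure_abs_ge_le_of_hasSubgaussianMGF
    (hasSubgaussianMGF_of_convexOn_of_lipschitz μ hMpos hX'm hind' (fun i ω => hτM _) hf hL)
    (t := t / 4) (by linarith)
  set R : Ω → ℝ := fun ω => ‖randVec X ω - randVec X' ω‖ with hR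
  have hRm : Measurable R := ((measurable_randVec hX).sub (measurable_randVec hX'm)).norm
  have hR0 : ∀ ω, 0 ≤ R ω := fun ω => norm_nonneg _
  have hRsqrt : ∀ ω, R ω = Real.sqrt (∑ i, if M < |X i ω| then X i ω ^ 2 else 0) := by
    intro ω
    simp only [hR, randVec]
    rw [norm_toLp_sub]
    congr 1
    refine Finset.sum_congr rfl fun i _ => ?_
    by_cases h : |X i ω| ≤ M
    · simp [hX', hτ, h]
    · simp [hX', hτ, h, not_le.1 h]
  have hRsq : ∀ ω, R ω ^ 2 = a ^ 2 * ∑ i, if M < |X i ω| then (X i ω / a) ^ 2 else 0 := by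
    intro ω
    rw [hRsqrt, Real.sq_sqrt (Finset.sum_nonneg fun i _ => by split_ifs <;> positivity),
      Finset.mul_sum]
    refine Finset.sum_congr rfl fun i _ => ?_
    split_ifs
    · field_simp
    · simp
  have hRsum : ∀ ω, R ω ≤ ∑ i, if M < |X i ω| then |X i ω| else 0 := by
    intro ω
    have h0 : ∀ i ∈ Finset.univ, 0 ≤ if M < |X i ω| then |X i ω| else 0 := fun i _ => by
      split_ifs <;> positivity
    rw [hRsqrt, Real.sqrt_le_iff]
    refine ⟨Finset.sum_nonneg h0, le_trans (le_of_eq ?_) (Finset.sum_sq_le_sq_sum_of_nonneg h0)⟩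
    refine Finset.sum_congr rfl fun i _ => ?_
    split_ifs <;> simp
  -- R is at most the sum of the large |X_i|, and the moment comparison is applied with H the
  -- identity.
  have hRlint : ∫⁻ ω, ENNReal.ofReal (R ω) ∂μ ≤ ENNReal.ofReal (2 * m) := by
    have hhalf : 1 / 2 ≤ μ {ω | maxAbs X ω ≤ M} := by
      have := half_le_measure_maxAbs_le hX hint (hmdef ▸ hm)
      rwa [← hmdef] at this
    have h1 := sum_lintegral_ite_lt_abs_le hX hind hhalf ENNReal.measurable_ofReal
    calc _ ≤ ∫⁻ ω, ∑ i, (if M < |X i ω| then ENNReal.ofReal |X i ω| else 0) ∂μ := by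
          refine lintegral_mono fun ω => ?_
          refine (ENNReal.ofReal_le_ofReal (hRsum ω)).trans (le_of_eq ?_)
          rw [ENNReal.ofReal_sum_of_nonneg fun i _ => by split_ifs <;> positivity]
          refine Finset.sum_congr rfl fun i _ => ?_
          split_ifs <;> simp
      _ = ∑ i, ∫⁻ ω, (if M < |X i ω| then ENNReal.ofReal |X i ω| else 0) ∂μ := by
          refine lintegral_finsetSum _ fun i _ => ?_
          exact Measurable.ite (measurableSet_lt measurable_const (hX i).abs)
            (hX i).abs.ennreal_ofReal measurable_const
      _ ≤ _ := h1
      _ = _ := by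
          rw [← ofReal_integral_eq_lintegral_ofReal hint (ae_of_all _ (maxAbs_nonneg X)), ← hmdef,
            ENNReal.ofReal_mul zero_le_two, ENNReal.ofReal_ofNat]
  have hRint : Integrable R μ := by
    refine ⟨hRm.aestronglyMeasurable, ?_⟩
    rw [hasFiniteIntegral_iff_ofReal (ae_of_all _ hR0)]
    exact hRlint.trans_lt ENNReal.ofReal_lt_top
  have hRm' : ∫ ω, R ω ∂μ ≤ 2 * m := by
    rw [integral_eq_lintegral_of_nonneg_ae (ae_of_all _ hR0) hRm.aestronglyMeasurable]
    exact ENNReal.toReal_le_of_le_ofReal hMpos.le hRlint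
  have hfR : ∀ ω, |f (randVec X ω) - f (randVec X' ω)| ≤ R ω := by
    intro ω
    have := hL.dist_le_mul (randVec X ω) (randVec X' ω)
    rwa [NNReal.coe_one, one_mul, Real.dist_eq, dist_eq_norm] at this
  have hfX := integrable_comp_randVec hX hint hL
  have hfX' : Integrable (fun ω => f (randVec X' ω)) μ := by
    have h1 : Integrable (fun ω => f (randVec X ω) - f (randVec X' ω)) μ := by
      refine hRint.mono' ?_ (ae_of_all _ hfR)
      exact ((hL.continuous.measurable.comp (measurable_randVec hX)).sub
        (hL.continuous.measurable.comp (measurable_randVec hX'm))).aestronglyMeasurable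
    exact (hfX.sub h1).congr (ae_of_all _ fun ω => by simp)
  have hmean : |(∫ ω, f (randVec X ω) ∂μ) - ∫ ω, f (randVec X' ω) ∂μ| ≤ t / 4 := by
    rw [← integral_sub hfX hfX']
    refine (norm_integral_le_integral_norm (fun ω => f (randVec X ω) - f (randVec X' ω))).trans ?_
    refine (integral_mono (hfX.sub hfX').norm hRint hfR).trans ?_
    linarith
  -- The deviation t is split as t/4 for f(X'), t/2 for R and t/4 for the difference of means, which
  -- is at most 2m ≤ t/4.
  have hincl : {ω | t < |f (randVec X ω) - ∫ ω', f (randVec X ω') ∂μ|} ⊆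
      {ω | t / 4 ≤ |f (randVec X' ω) - ∫ ω', f (randVec X' ω') ∂μ|} ∪
      {ω | (t / 2) ^ 2 / a ^ 2 < ∑ i, if M < |X i ω| then (X i ω / a) ^ 2 else 0} := by
    intro ω hω
    by_contra hcon
    rw [Set.mem_union, not_or] at hcon
    obtain ⟨h1, h2⟩ := hcon
    simp only [Set.mem_ofPred_eq, not_le, not_lt] at h1 h2 hω
    rw [le_div_iff₀ (by positivity), mul_comm, ← hRsq] at h2
    have h3 : R ω ≤ t / 2 := (abs_le_of_sq_le_sq' h2 (by linarith)).2
    have h4 := hfR ω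
    have h5 : f (randVec X ω) - ∫ ω', f (randVec X ω') ∂μ =
        (f (randVec X ω) - f (randVec X' ω)) +
        (f (randVec X' ω) - ∫ ω', f (randVec X' ω') ∂μ) -
        ((∫ ω', f (randVec X ω') ∂μ) - ∫ ω', f (randVec X' ω') ∂μ) := by ring
    rw [h5] at hω
    have h6 := abs_sub ((f (randVec X ω) - f (randVec X' ω)) +
        (f (randVec X' ω) - ∫ ω', f (randVec X' ω') ∂μ))
        ((∫ ω', f (randVec X ω') ∂μ) - ∫ ω', f (randVec X' ω') ∂μ)
    have h7 := abs_add_le (f (randVec X ω) - f (randVec X' ω))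
        (f (randVec X' ω) - ∫ ω', f (randVec X' ω') ∂μ)
    linarith
  refine (measureReal_mono hincl).trans ((measureReal_union_le _ _).trans ?_)
  refine add_le_add (hsub.trans (le_of_eq ?_)) le_rfl
  -- The proxy is 16(2m)² = 64m², and (t/4)²/(2·64m²) = t²/(2048m²).
  rw [Real.coe_toNNReal _ (by positivity), hM]
  congr 2
  field_simp
  ring

/-! ### Integrability and the choice of the final constant. -/

namespace IsOrlicz

variable {Ψ : ℝ → ℝ}

theorem pos_one (h : IsOrlicz Ψ) : 0 < Ψ 1 := by
  have := h.strictMonoOn (Set.mem_Ici.2 le_rfl) (Set.mem_Ici.2 zero_le_one) zero_lt_one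
  rwa [h.map_zero] at this

/-- Convexity and Ψ(0) = 0 give x²Ψ(1) ≤ Ψ(x²) for x ≥ 1, so a finite Φ-moment forces integrability.
-/
theorem le_one_add_map_sq_div (h : IsOrlicz Ψ) {x : ℝ} (hx : 0 ≤ x) :
    x ≤ 1 + 1 / Ψ 1 * Ψ (x ^ 2) := by
  have h1 := h.pos_one
  have h2 := h.nonneg (sq_nonneg x)
  rcases le_total x 1 with hx1 | hx1
  · have : 0 ≤ 1 / Ψ 1 * Ψ (x ^ 2) := by positivity
    linarith
  · have hx0 : 0 < x := by linarith
    have hinv : 1 / x ^ 2 ≤ 1 := by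
      rw [div_le_one (by positivity)]
      nlinarith
    have h3 := h.map_mul_le (by positivity : 0 ≤ 1 / x ^ 2) hinv (sq_nonneg x)
    rw [one_div_mul_cancel (by positivity), one_div_mul_eq_div, le_div_iff₀ (by positivity)] at h3
    have h4 : x ^ 2 ≤ 1 / Ψ 1 * Ψ (x ^ 2) := by
      rw [one_div_mul_eq_div, le_div_iff₀ h1]
      linarith
    nlinarith

end IsOrlicz

theorem integrable_of_lintegral_orlicz_sq {Ω : Type*} [MeasurableSpace Ω] {μ : Measure Ω}
    [IsProbabilityMeasure μ] {Ψ : ℝ → ℝ} (h : IsOrlicz Ψ) {Y : Ω → ℝ} (hY : Measurable Y)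
    (hY0 : ∀ ω, 0 ≤ Y ω) {a : ℝ} (ha : 0 < a)
    (h1 : ∫⁻ ω, ENNReal.ofReal (Ψ ((Y ω / a) ^ 2)) ∂μ ≤ 1) : Integrable Y μ := by
  refine ⟨hY.aestronglyMeasurable, ?_⟩
  rw [hasFiniteIntegral_iff_ofReal (ae_of_all _ hY0)]
  have hp := h.pos_one
  calc _ ≤ ∫⁻ ω, ENNReal.ofReal a *
        (1 + ENNReal.ofReal (1 / Ψ 1) * ENNReal.ofReal (Ψ ((Y ω / a) ^ 2))) ∂μ := by
        refine lintegral_mono fun ω => ?_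
        have h2 := h.le_one_add_map_sq_div (div_nonneg (hY0 ω) ha.le)
        have h3 := h.nonneg (sq_nonneg (Y ω / a))
        rw [← ENNReal.ofReal_mul (by positivity), ← ENNReal.ofReal_one,
          ← ENNReal.ofReal_add zero_le_one (by positivity), ← ENNReal.ofReal_mul ha.le]
        refine ENNReal.ofReal_le_ofReal ?_
        rw [div_le_iff₀ ha] at h2
        linarith
    _ = ENNReal.ofReal a * (1 + ENNReal.ofReal (1 / Ψ 1) *
        ∫⁻ ω, ENNReal.ofReal (Ψ ((Y ω / a) ^ 2)) ∂μ) := by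
        rw [lintegral_const_mul' _ _ ENNReal.ofReal_ne_top, lintegral_add_left measurable_const,
          lintegral_const_mul' _ _ ENNReal.ofReal_ne_top]
        simp
    _ < ∞ := by
        refine ENNReal.mul_lt_top ENNReal.ofReal_lt_top (ENNReal.add_lt_top.2
          ⟨ENNReal.one_lt_top, ENNReal.mul_lt_top ENNReal.ofReal_lt_top (h1.trans_lt ?_)⟩)
        exact ENNReal.one_lt_top

theorem exists_lintegral_le_one_of_orliczNorm_lt {Ω : Type*} [MeasurableSpace Ω] {μ : Measure Ω}
    {Φ : ℝ → ℝ} {Y : Ω → ℝ} {b : ℝ≥0∞} (h : orliczNorm Φ Y μ < b) :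
    ∃ a : ℝ, 0 < a ∧ ∫⁻ ω, ENNReal.ofReal (Φ (|Y ω| / a)) ∂μ ≤ 1 ∧ ENNReal.ofReal a < b := by
  simpa only [orliczNorm, iInf_lt_iff, exists_prop] using h

theorem measureReal_deviation_eq_zero {Ω : Type*} [MeasurableSpace Ω] {μ : Measure Ω}
    [IsProbabilityMeasure μ] {N : ℕ} {X : Fin N → Ω → ℝ} (hint : Integrable (maxAbs X) μ)
    (h0 : ∫ ω, maxAbs X ω ∂μ = 0) (f : EuclideanSpace ℝ (Fin N) → ℝ) {t : ℝ} (ht : 0 < t) :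
    μ.real {ω | t < |f (randVec X ω) - ∫ ω', f (randVec X ω') ∂μ|} = 0 := by
  have h1 := (integral_eq_zero_iff_of_nonneg (maxAbs_nonneg X) hint).1 h0
  have h2 : ∀ᵐ ω ∂μ, f (randVec X ω) = f 0 := by
    filter_upwards [h1] with ω hω
    have h3 : randVec X ω = 0 := by
      rw [← norm_le_zero_iff]
      refine (norm_le_card_mul_maxAbs X ω).trans ?_
      rw [hω]
      simp
    rw [h3]
  have h4 : ∫ ω, f (randVec X ω) ∂μ = f 0 := by
    rw [integral_congr_ae h2]
    simp
  rw [measureReal_def, measure_eq_zero_iff_ae_notMem.2, ENNReal.toReal_zero]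
  filter_upwards [h2] with ω hω
  rw [h4, hω]
  simpa using ht.le

/-- Trades the constant B for the required 2 at the price of a factor 1/(2B) on y. For y ≤ 2B the
new bound is at least 1, hence trivial. -/
theorem le_two_div_of_le_div {q y B : ℝ} (hB : 1 ≤ B) (hy : 0 ≤ y) (hq1 : q ≤ 1)
    (hq : q ≤ B / (1 + y)) : q ≤ 2 / (1 / (2 * B) * y + 1) := by
  have hB0 : 0 < B := by linarith
  have e : 2 / (1 / (2 * B) * y + 1) = 4 * B / (y + 2 * B) := by field_simp; ring
  rw [e]
  rcases le_total y (2 * B) with h | h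
  · refine hq1.trans ?_
    rw [one_le_div (by positivity)]
    linarith
  · refine hq.trans ?_
    rw [div_le_div_iff₀ (by positivity) (by positivity)]
    nlinarith

theorem proposition4p6 (Ψ Φ : ℝ → ℝ) (hΨ : IsOrlicz Ψ) (hHJ : SatisfiesHJ Ψ)
    (hΦ : ∀ x : ℝ, 0 ≤ x → Φ x = Ψ (x ^ 2)) :
    ∃ c : ℝ, 0 < c ∧
      ∀ {Ω : Type*} [MeasurableSpace Ω] (μ : Measure Ω) [IsProbabilityMeasure μ]
        (N : ℕ) (X : Fin N → Ω → ℝ),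
        (∀ i, Measurable (X i)) → iIndepFun X μ → orliczNorm Φ (maxAbs X) μ < ∞ →
        ∀ f : EuclideanSpace ℝ (Fin N) → ℝ, ConvexOn ℝ Set.univ f → LipschitzWith 1 f →
          Integrable (maxAbs X) μ ∧ Integrable (fun ω => f (randVec X ω)) μ ∧
          ∀ t : ℝ, 0 < t →
            ((∫ ω, maxAbs X ω ∂μ) ≠ 0 →
              μ.real {ω | t < |f (randVec X ω) - ∫ ω', f (randVec X ω') ∂μ|} ≤
                2 * Real.exp (-(c * (t ^ 2 / (∫ ω, maxAbs X ω ∂μ) ^ 2))) +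
                  2 / (Φ (c * (t / (orliczNorm Φ (maxAbs X) μ).toReal)) + 1)) ∧
            -- the degenerate case `X = 0` almost surely, where the bound is read as `0`
            ((∫ ω, maxAbs X ω ∂μ) = 0 →
              μ.real {ω | t < |f (randVec X ω) - ∫ ω', f (randVec X ω') ∂μ|} = 0) := by
  obtain ⟨γ, B, hγ, hB, htail⟩ := exists_tail_bound_sum_sq hΨ hHJ
  have hB0 : 0 < B := by linarith
  set θ := 1 / (2 * B) with hθ
  have hθ0 : 0 < θ := by positivity
  have hθ1 : θ ≤ 1 := by
    rw [hθ, div_le_one (by positivity)]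
    linarith
  -- The first entry is the sub-Gaussian constant. In the second, θ absorbs B, and 16 comes from
  -- (t/2)²/(2L)² = t²/(16L²).
  set c := min (1 / 2048) (Real.sqrt (θ * γ / 16)) with hc
  have hc0 : 0 < c := by positivity
  have hc1 : c ≤ 1 / 2048 := min_le_left _ _
  have hc2 : c ^ 2 ≤ θ * γ / 16 := by
    rw [← Real.sq_sqrt (by positivity : 0 ≤ θ * γ / 16)]
    exact pow_le_pow_left₀ hc0.le (min_le_right _ _) 2
  refine ⟨c, hc0, ?_⟩
  intro Ω _ μ _ N X hX hind hfin f hf hL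
  have hadm : ∀ a : ℝ, 0 < a → ∫⁻ ω, ENNReal.ofReal (Φ (|maxAbs X ω| / a)) ∂μ ≤ 1 →
      ∫⁻ ω, ENNReal.ofReal (Ψ ((maxAbs X ω / a) ^ 2)) ∂μ ≤ 1 := by
    intro a ha h
    refine le_trans (le_of_eq (lintegral_congr fun ω => ?_)) h
    rw [abs_of_nonneg (maxAbs_nonneg X ω), hΦ _ (div_nonneg (maxAbs_nonneg X ω) ha.le)]
  have hint : Integrable (maxAbs X) μ := by
    obtain ⟨a, ha, ha1, -⟩ := exists_lintegral_le_one_of_orliczNorm_lt hfin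
    exact integrable_of_lintegral_orlicz_sq hΨ (measurable_maxAbs hX) (maxAbs_nonneg X) ha
      (hadm a ha ha1)
  refine ⟨hint, integrable_comp_randVec hX hint hL, fun t ht => ⟨fun hm0 => ?_, fun h0 =>
    measureReal_deviation_eq_zero hint h0 f ht⟩⟩
  set m := ∫ ω, maxAbs X ω ∂μ with hmdef
  have hm : 0 < m := lt_of_le_of_ne (integral_nonneg (maxAbs_nonneg X)) hm0.symm
  set L := (orliczNorm Φ (maxAbs X) μ).toReal with hLdef
  have hL0 : 0 ≤ L := ENNReal.toReal_nonneg
  have hΦeq : Φ (c * (t / L)) = Ψ ((c * (t / L)) ^ 2) := hΦ _ (by positivity)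
  have hΦ0 : 0 ≤ Φ (c * (t / L)) := hΦeq ▸ hΨ.nonneg (sq_nonneg _)
  -- For t < 8m the exponent is at most 1/2, so the Gaussian term alone is at least 2(1 - 1/2) = 1.
  rcases lt_or_ge t (8 * m) with htm | htm
  · have h1 : c * (t ^ 2 / m ^ 2) ≤ 1 / 2 := by
      have : t ^ 2 / m ^ 2 ≤ 64 := by
        rw [div_le_iff₀ (by positivity)]
        nlinarith
      nlinarith
    have h2 := Real.add_one_le_exp (-(c * (t ^ 2 / m ^ 2)))
    have h3 : 0 ≤ 2 / (Φ (c * (t / L)) + 1) := by positivity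
    linarith [measureReal_le_one (μ := μ)
      (s := {ω | t < |f (randVec X ω) - ∫ ω', f (randVec X ω') ∂μ|})]
  -- If L = 0, then t / L = 0 by convention, so the second term equals 2 and the bound is trivial.
  rcases hL0.eq_or_lt with hLz | hLpos
  · have h1 : Φ (c * (t / L)) = 0 := by
      rw [hΦeq, ← hLz]
      simp [hΨ.map_zero]
    rw [h1]
    have h2 := Real.exp_pos (-(c * (t ^ 2 / m ^ 2)))
    linarith [measureReal_le_one (μ := μ)
      (s := {ω | t < |f (randVec X ω) - ∫ ω', f (randVec X ω') ∂μ|})]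
  -- Working with an admissible a < 2L avoids having to show that the infimum is attained.
  have hlt : orliczNorm Φ (maxAbs X) μ < ENNReal.ofReal (2 * L) := by
    rw [← ENNReal.ofReal_toReal hfin.ne, ← hLdef]
    exact (ENNReal.ofReal_lt_ofReal_iff (by linarith)).2 (by linarith)
  obtain ⟨a, ha, ha1, ha2⟩ := exists_lintegral_le_one_of_orliczNorm_lt hlt
  have haL : a < 2 * L := (ENNReal.ofReal_lt_ofReal_iff (by linarith)).1 ha2
  have hhalf := half_le_measure_maxAbs_le hX hint hm
  have hq := htail μ N X hX hind a (2 * m) (hadm a ha ha1) hhalf ((t / 2) ^ 2 / a ^ 2)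
    (by positivity)
  refine (measure_lt_abs_sub_integral_le hX hind hint hmdef hm hf hL ha htm).trans ?_
  refine add_le_add ?_ ?_
  · gcongr
    calc c * (t ^ 2 / m ^ 2) ≤ 1 / 2048 * (t ^ 2 / m ^ 2) := by gcongr
      _ = _ := by field_simp
  · set y := γ * ((t / 2) ^ 2 / a ^ 2) with hy
    have hy0 : 0 ≤ y := by positivity
    refine (le_two_div_of_le_div hB (hΨ.nonneg hy0) measureReal_le_one hq).trans ?_
    rw [← hθ, hΦeq]
    have h1 : (c * (t / L)) ^ 2 ≤ θ * y := by
      calc (c * (t / L)) ^ 2 = c ^ 2 * (t ^ 2 / L ^ 2) := by ring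
        _ ≤ θ * γ / 16 * (t ^ 2 / L ^ 2) := by gcongr
        _ = θ * (γ * ((t / 2) ^ 2 / (2 * L) ^ 2)) := by field_simp; ring
        _ ≤ _ := by rw [hy]; gcongr
    have h2 := hΨ.mono (sq_nonneg _) h1
    have h3 := hΨ.map_mul_le hθ0.le hθ1 hy0
    have h4 := hΨ.nonneg (sq_nonneg (c * (t / L)))
    gcongr
    exact h2.trans h3
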